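/- Let $G$ be a finite simple undirected graph. A set $S\subseteq V(G)$ is a feedback vertex set of $G$ if $G-S$ is a forest, and it is minimal if no proper subset of $S$ is a feedback vertex set of $G$. Let $\mathsf{vc}(G)$ be the vertex cover number of $G$, i.e. the minimum size of a set of vertices that meets every edge. In the problem Max Min FVS the input is a finite simple undirected graph $G$ and an integer $k\in\mathbb{N}$, and the question is whether $G$ has a minimal feedback vertex set of size at least $k$. Theorem. Max Min FVS can be solved in time $2^{O(\mathsf{vc}(G)\log \mathsf{vc}(G))}\cdot n^{O(1)}$, where $n=|V(G)|$. That is, there are one deterministic algorithm (a program of a unit-cost random access machine with addition, truncated subtraction and indirect addressing, which receives $n$, $k$ and the adjacency matrix of $G$) and constants $A,B,C\in\mathbb{N}$ such that for every $n\ge 0$, every graph $G$ with vertex set $\{0,\dots,n-1\}$ and every $k\in\mathbb{N}$ the algorithm halts on $(G,k)$ after at most $$A\cdot 2^{B\,\mathsf{vc}(G)\log_2 \mathsf{vc}(G)}\cdot (n+1)^{C}$$ steps (with $0\log_2 0=0$) and answers correctly whether $G$ has a minimal feedback vertex set of size at least $k$. -/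

import Mathlib

/-- `S` is a feedback vertex set of `G`: deleting `S` leaves a forest. -/
def SimpleGraph.IsFVS {V : Type*} (G : SimpleGraph V) (S : Finset V) : Prop :=
  (G.induce ((S : Set V)ᶜ)).IsAcyclic

/-- The question of Max Min FVS: `G` has an inclusion-minimal feedback vertex set of size at
least `k`. -/
def MaxMinFVS {V : Type*} (G : SimpleGraph V) (k : ℕ) : Prop :=
  ∃ S : Finset V, Minimal G.IsFVS S ∧ k ≤ S.card

/-- The vertex cover number as a natural number (it is finite for a finite graph, see
`vc_spec`). -/
noncomputable def vc {V : Type*} [Fintype V] (G : SimpleGraph V) : ℕ :=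
  G.vertexCoverNum.toNat

theorem vc_spec {V : Type*} [Fintype V] (G : SimpleGraph V) : (vc G : ℕ∞) = G.vertexCoverNum := by
  exact ENat.natCast_toNat SimpleGraph.vertexCoverNum_ne_top_of_finite

namespace RAM

/-- A configuration of the random access machine: registers, which a program names directly, and
a memory, which it reads and writes through addresses held in registers. All cells hold natural
numbers. -/
@[ext]
structure State where
  reg : ℕ → ℕ
  mem : ℕ → ℕ

/-- Assignment to a register. -/
def State.setReg (s : State) (x v : ℕ) : State :=
  { s with reg := Function.update s.reg x v }

/-- Assignment to a memory cell. -/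
def State.setMem (s : State) (a v : ℕ) : State :=
  { s with mem := Function.update s.mem a v }

/-- Programs of the random access machine. The arithmetic is addition and truncated subtraction;
there is no multiplication, so the unit cost measure below is polynomially related to Turing
machine time. A program names only finitely many registers. -/
inductive Prog where
  /-- no operation -/
  | skip : Prog
  /-- `r_x := c` -/
  | const (x c : ℕ) : Prog
  /-- `r_x := r_y` -/
  | move (x y : ℕ) : Prog
  /-- `r_x := r_y + r_z` -/
  | add (x y z : ℕ) : Prog
  /-- `r_x := max (r_y - r_z) 0` -/
  | sub (x y z : ℕ) : Prog
  /-- `r_x := M[r_y]` -/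
  | load (x y : ℕ) : Prog
  /-- `M[r_x] := r_y` -/
  | store (x y : ℕ) : Prog
  /-- first `p`, then `q` -/
  | seq (p q : Prog) : Prog
  /-- if `r_x ≠ 0` then `p` else `q` -/
  | ite (x : ℕ) (p q : Prog) : Prog
  /-- while `r_x ≠ 0` do `p` -/
  | loop (x : ℕ) (p : Prog) : Prog

/-- `Exec p s s' t`: the program `p`, started in `s`, halts in `s'` after exactly `t` steps. Every
elementary instruction and every evaluation of a test is one step. -/
inductive Exec : Prog → State → State → ℕ → Prop where
  | skip (s : State) : Exec .skip s s 1
  | const (x c : ℕ) (s : State) : Exec (.const x c) s (s.setReg x c) 1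
  | move (x y : ℕ) (s : State) : Exec (.move x y) s (s.setReg x (s.reg y)) 1
  | add (x y z : ℕ) (s : State) : Exec (.add x y z) s (s.setReg x (s.reg y + s.reg z)) 1
  | sub (x y z : ℕ) (s : State) : Exec (.sub x y z) s (s.setReg x (s.reg y - s.reg z)) 1
  | load (x y : ℕ) (s : State) : Exec (.load x y) s (s.setReg x (s.mem (s.reg y))) 1
  | store (x y : ℕ) (s : State) : Exec (.store x y) s (s.setMem (s.reg x) (s.reg y)) 1
  | seq {p q : Prog} {s s' s'' : State} {t t' : ℕ} :
      Exec p s s' t → Exec q s' s'' t' → Exec (.seq p q) s s'' (t + t')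
  | ite_true {x : ℕ} {p q : Prog} {s s' : State} {t : ℕ} :
      s.reg x ≠ 0 → Exec p s s' t → Exec (.ite x p q) s s' (t + 1)
  | ite_false {x : ℕ} {p q : Prog} {s s' : State} {t : ℕ} :
      s.reg x = 0 → Exec q s s' t → Exec (.ite x p q) s s' (t + 1)
  | loop_done {x : ℕ} {p : Prog} {s : State} :
      s.reg x = 0 → Exec (.loop x p) s s 1
  | loop_step {x : ℕ} {p : Prog} {s s' s'' : State} {t t' : ℕ} :
      s.reg x ≠ 0 → Exec p s s' t → Exec (.loop x p) s' s'' t' →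
        Exec (.loop x p) s s'' (t + t' + 1)

/-- The machine is deterministic: final state and number of steps are functions of program and
initial state. -/
theorem Exec.det {p : Prog} {s s₁ s₂ : State} {t₁ t₂ : ℕ}
    (h₁ : Exec p s s₁ t₁) (h₂ : Exec p s s₂ t₂) : s₁ = s₂ ∧ t₁ = t₂ := by
  induction h₁ generalizing s₂ t₂ with
  | seq _ _ ih ih' =>
    cases h₂ with
    | seq a b =>
      obtain ⟨rfl, rfl⟩ := ih a
      obtain ⟨rfl, rfl⟩ := ih' b
      exact ⟨rfl, rfl⟩
  | ite_true hx _ ih =>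
    cases h₂ with
    | ite_true _ a => obtain ⟨rfl, rfl⟩ := ih a; exact ⟨rfl, rfl⟩
    | ite_false hx' _ => exact absurd hx' hx
  | ite_false hx _ ih =>
    cases h₂ with
    | ite_true hx' _ => exact absurd hx hx'
    | ite_false _ a => obtain ⟨rfl, rfl⟩ := ih a; exact ⟨rfl, rfl⟩
  | loop_done hx =>
    cases h₂ with
    | loop_done _ => exact ⟨rfl, rfl⟩
    | loop_step hx' _ _ => exact absurd hx hx'
  | loop_step hx _ _ ih ih' =>
    cases h₂ with
    | loop_done hx' => exact absurd hx' hx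
    | loop_step _ a b =>
      obtain ⟨rfl, rfl⟩ := ih a
      obtain ⟨rfl, rfl⟩ := ih' b
      exact ⟨rfl, rfl⟩
  | _ => cases h₂; exact ⟨rfl, rfl⟩

open Classical in
/-- The input `(G, k)` for a graph `G` with vertices `0, …, n-1`: register 0 holds `n`, register 1
holds `k`, the memory holds the adjacency matrix of `G` row by row, and all else is 0. -/
noncomputable def input {n : ℕ} (G : SimpleGraph (Fin n)) (k : ℕ) : State where
  reg := fun x => if x = 0 then n else if x = 1 then k else 0
  mem := fun a => if ∃ i j : Fin n, a = i.val * n + j.val ∧ G.Adj i j then 1 else 0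

/-- On the input `(G, k)` the program `p` halts after at most `T` steps and leaves in register 0
the truth value (1 for yes, 0 for no) of `Q`. -/
def AnswersWithin (p : Prog) {n : ℕ} (G : SimpleGraph (Fin n)) (k : ℕ) (Q : Prop) (T : ℝ) : Prop :=
  ∃ (s : State) (t : ℕ), Exec p (input G k) s t ∧ (t : ℝ) ≤ T ∧
    (Q → s.reg 0 = 1) ∧ (¬ Q → s.reg 0 = 0)

end RAM

/-!
The minimal feedback vertex sets are the complements of the maximal induced forests `F`, so a
smallest maximal induced forest is sought. Let `C` be a vertex cover. A vertex outside `C` with at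
most one neighbour in `F ∩ C` (a leaf) can be added to every forest with that trace on `C`, so that
all leaves lie in `F` and can be recovered from `F ∩ C`. The other vertices of `F` outside `C` (the
branches) are at most `|F ∩ C|` in number, because `F` is a forest. Every vertex `s` outside `F`
closes a cycle through two of its neighbours `P s` and `Q s` in the same tree of `F`. A branch may
be exchanged for any vertex outside `C` that has the same neighbours in `F ∩ C` and is adjacent to
those vertices `s` of `C` outside `F` for which the branch is `P s` or `Q s`: the result is again a
maximal induced forest of the same size. Such a vertex is found greedily once these neighbours are
marked, hence some maximal induced forest of each attained size is built from `4 |C|` instructions,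
each of which is one of two fixed ones or adds or marks a vertex of `C`.

The endpoints of a greedy maximal matching form a vertex cover with at most `2 vc(G)` vertices, for
which all `(2 |C| + 2) ^ (4 |C|)` lists of instructions are tried. The search is written in a
language of bounded loops, whose programs compile to the random access machine; the time of such a
program is bounded by a polynomial in a common bound for the lengths of its loops.
-/

namespace RAM

/-! ### A language of bounded loops -/

section Language

/-- Expressions over variables `X` and arrays `A`; `inp e` is the cell number `e` of the input. -/
inductive Expr (X A : Type*)
  | lit (c : ℕ)
  | var (x : X)
  | add (e f : Expr X A)
  | sub (e f : Expr X A)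
  | get (a : A) (e : Expr X A)
  | inp (e : Expr X A)

/-- Statements of a structured language in which every loop is bounded: `loop i x p` performs `p`
for `i = 0, …, m - 1`, where `m` is the value of `x` on entry. -/
inductive Stmt (X A : Type*)
  | skip
  | set (x : X) (e : Expr X A)
  | put (a : A) (e f : Expr X A)
  | seq (p q : Stmt X A)
  | ite (e : Expr X A) (p q : Stmt X A)
  | loop (i x : X) (p : Stmt X A)

/-- First `p`, then `q`. -/
infixr:65 " ;; " => Stmt.seq

/-- The values of all variables and all array cells. -/
structure Env (X A : Type*) where
  var : X → ℕ
  arr : A → ℕ → ℕ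

variable {X A : Type*}

/-- The value of an expression, where `M` is the input. -/
def Expr.eval (M : ℕ → ℕ) (s : Env X A) : Expr X A → ℕ
  | .lit c => c
  | .var x => s.var x
  | .add e f => e.eval M s + f.eval M s
  | .sub e f => e.eval M s - f.eval M s
  | .get a e => s.arr a (e.eval M s)
  | .inp e => M (e.eval M s)

/-- Assignment to a variable. -/
def Env.set [DecidableEq X] (s : Env X A) (x : X) (v : ℕ) : Env X A :=
  { s with var := Function.update s.var x v }

/-- Assignment to an array cell. -/
def Env.put [DecidableEq A] (s : Env X A) (a : A) (i v : ℕ) : Env X A :=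
  { s with arr := Function.update s.arr a (Function.update (s.arr a) i v) }

theorem Env.set_var [DecidableEq X] (s : Env X A) (x y : X) (v : ℕ) :
    (s.set x v).var y = if y = x then v else s.var y := by
  simp [Env.set, Function.update_apply]

@[simp]
theorem Env.set_arr [DecidableEq X] (s : Env X A) (x : X) (v : ℕ) :
    (s.set x v).arr = s.arr := rfl

@[simp]
theorem Env.put_var [DecidableEq A] (s : Env X A) (a : A) (i v : ℕ) :
    (s.put a i v).var = s.var := rfl

theorem Env.put_arr [DecidableEq A] (s : Env X A) (a b : A) (i j v : ℕ) :
    (s.put a i v).arr b j = if b = a ∧ j = i then v else s.arr b j := by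
  simp only [Env.put, Function.update_apply]
  split_ifs <;> simp_all

theorem Env.put_arr_of_ne [DecidableEq A] (s : Env X A) {a b : A} (i v : ℕ) (h : b ≠ a) :
    (s.put a i v).arr b = s.arr b := by
  simp [Env.put, h]

/-- `repeatFor i f m s` performs `f` on `s` for `i = 0, …, m - 1`. -/
def repeatFor [DecidableEq X] (i : X) (f : Env X A → Env X A) : ℕ → Env X A → Env X A
  | 0, s => s
  | m + 1, s => f ((repeatFor i f m s).set i m)

/-- `p.writes x`: the statement `p` contains an assignment to the variable `x`. -/
def Stmt.writes [DecidableEq X] (x : X) : Stmt X A → Bool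
  | .skip => false
  | .set y _ => x = y
  | .put _ _ _ => false
  | .seq p q => p.writes x || q.writes x
  | .ite _ p q => p.writes x || q.writes x
  | .loop i _ p => x = i || p.writes x

/-- `p.writesArr a`: the statement `p` contains an assignment to a cell of the array `a`. -/
def Stmt.writesArr [DecidableEq A] (a : A) : Stmt X A → Bool
  | .skip => false
  | .set _ _ => false
  | .put b _ _ => a = b
  | .seq p q => p.writesArr a || q.writesArr a
  | .ite _ p q => p.writesArr a || q.writesArr a
  | .loop _ _ p => p.writesArr a

variable [DecidableEq X] [DecidableEq A] {M : ℕ → ℕ} {p q : Stmt X A} {s s' : Env X A}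

/-- The effect of a statement on the environment, where `M` is the input. -/
def Stmt.eval (M : ℕ → ℕ) : Stmt X A → Env X A → Env X A
  | .skip, s => s
  | .set x e, s => s.set x (e.eval M s)
  | .put a e f, s => s.put a (e.eval M s) (f.eval M s)
  | .seq p q, s => q.eval M (p.eval M s)
  | .ite e p q, s => if e.eval M s ≠ 0 then p.eval M s else q.eval M s
  | .loop i x p, s => repeatFor i (p.eval M) (s.var x) s

theorem Stmt.eval_seq (M : ℕ → ℕ) (p q : Stmt X A) (s : Env X A) :
    (p ;; q).eval M s = q.eval M (p.eval M s) := rfl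

theorem Stmt.eval_ite_pos {e : Expr X A} (h : e.eval M s ≠ 0) (p q : Stmt X A) :
    (Stmt.ite e p q).eval M s = p.eval M s := if_pos h

theorem Stmt.eval_ite_neg {e : Expr X A} (h : e.eval M s = 0) (p q : Stmt X A) :
    (Stmt.ite e p q).eval M s = q.eval M s := if_neg (not_not.2 h)

/-- The environments `s` and `s'` agree on everything that `p` does not write. -/
structure Stmt.Frame (p : Stmt X A) (s s' : Env X A) : Prop where
  var : ∀ x, p.writes x = false → s'.var x = s.var x
  arr : ∀ a, p.writesArr a = false → s'.arr a = s.arr a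

theorem Stmt.Frame.trans {s'' : Env X A} (h : p.Frame s s') (h' : p.Frame s' s'') :
    p.Frame s s'' :=
  ⟨fun x hx => (h'.var x hx).trans (h.var x hx), fun a ha => (h'.arr a ha).trans (h.arr a ha)⟩

theorem Stmt.Frame.mono (h : p.Frame s s') (hx : ∀ x, q.writes x = false → p.writes x = false)
    (ha : ∀ a, q.writesArr a = false → p.writesArr a = false) : q.Frame s s' :=
  ⟨fun x h' => h.var x (hx x h'), fun a h' => h.arr a (ha a h')⟩

theorem Stmt.Frame.set_index {i x : X} (h : (Stmt.loop i x p).Frame s s') (m : ℕ) :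
    (Stmt.loop i x p).Frame s (s'.set i m) := by
  refine ⟨fun y hy => ?_, h.arr⟩
  have hyi : y ≠ i := by
    rintro rfl
    simp [Stmt.writes] at hy
  rw [Env.set_var, if_neg hyi, h.var y hy]

theorem Stmt.frame_repeatFor {i x : X} (h : ∀ s, p.Frame s (p.eval M s)) (m : ℕ) (s : Env X A) :
    (Stmt.loop i x p).Frame s (repeatFor i (p.eval M) m s) := by
  induction m with
  | zero => exact ⟨fun _ _ => rfl, fun _ _ => rfl⟩
  | succ m ih =>
    refine (ih.set_index m).trans ((h _).mono (fun y hy => ?_) fun _ => id)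
    simp only [Stmt.writes, Bool.or_eq_false_iff] at hy
    exact hy.2

theorem Stmt.frame_eval (M : ℕ → ℕ) (p : Stmt X A) (s : Env X A) : p.Frame s (p.eval M s) := by
  induction p generalizing s with
  | skip => exact ⟨fun _ _ => rfl, fun _ _ => rfl⟩
  | set y e =>
    refine ⟨fun x hx => ?_, fun _ _ => rfl⟩
    have : x ≠ y := by simpa [Stmt.writes] using hx
    simp [Stmt.eval, Env.set_var, this]
  | put b e f =>
    exact ⟨fun _ _ => rfl, fun a ha =>
      Env.put_arr_of_ne _ _ _ (by simpa [Stmt.writesArr] using ha)⟩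
  | seq p q ihp ihq =>
    refine ((ihp s).mono ?_ ?_).trans ((ihq _).mono ?_ ?_) <;>
      simp +contextual [Stmt.writes, Stmt.writesArr]
  | ite e p q ihp ihq =>
    simp only [Stmt.eval]
    split_ifs
    · exact (ihp s).mono (by simp +contextual [Stmt.writes])
        (by simp +contextual [Stmt.writesArr])
    · exact (ihq s).mono (by simp +contextual [Stmt.writes])
        (by simp +contextual [Stmt.writesArr])
  | loop i x p ih => exact frame_repeatFor ih _ s

theorem Stmt.eval_var {x : X} (h : p.writes x = false) : (p.eval M s).var x = s.var x :=
  (p.frame_eval M s).var x h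

theorem Stmt.eval_arr {a : A} (h : p.writesArr a = false) : (p.eval M s).arr a = s.arr a :=
  (p.frame_eval M s).arr a h

theorem Stmt.loop_rule {i x : X} (Inv : ℕ → Env X A → Prop) (zero : Inv 0 s)
    (step : ∀ m < s.var x, ∀ s', (Stmt.loop i x p).Frame s s' → Inv m s' →
      Inv (m + 1) (p.eval M (s'.set i m))) :
    Inv (s.var x) ((Stmt.loop i x p).eval M s) := by
  have key : ∀ m ≤ s.var x, Inv m (repeatFor i (p.eval M) m s) := by
    intro m
    induction m with
    | zero => exact fun _ => zero
    | succ m ih =>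
      exact fun hm => step m hm _ (frame_repeatFor (p.frame_eval M) m s) (ih (by omega))
  exact key _ le_rfl

section FinLoop

variable {n : ℕ} {i x : X}

theorem Stmt.loop_rule_foldl {α : Type*} (hx : s.var x = n) (f : α → Fin n → α)
    (R : α → Env X A → Prop) {a : α} (hinit : R a s)
    (step : ∀ a (v : Fin n) s', (Stmt.loop i x p).Frame s s' → R a s' →
      R (f a v) (p.eval M (s'.set i v))) :
    R ((List.finRange n).foldl f a) ((Stmt.loop i x p).eval M s) := by
  subst hx
  have := Stmt.loop_rule (i := i) (p := p) (M := M)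
    (fun m s' => R (((List.finRange (s.var x)).take m).foldl f a) s') (by simpa using hinit)
    fun m hm s' fr h => by
      rw [List.take_add_one, List.getElem?_eq_getElem (by simpa), List.foldl_append]
      simpa using step _ ⟨m, hm⟩ s' fr h
  simpa [List.take_of_length_le] using this

theorem Stmt.loop_rule_finset (hx : s.var x = n) (Inv : Finset (Fin n) → Env X A → Prop)
    (empty : Inv ∅ s)
    (step : ∀ S (v : Fin n), v ∉ S → ∀ s', (Stmt.loop i x p).Frame s s' → Inv S s' →
      Inv (insert v S) (p.eval M (s'.set i v))) :
    Inv Finset.univ ((Stmt.loop i x p).eval M s) := by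
  subst hx
  have := Stmt.loop_rule (i := i) (p := p) (M := M)
    (fun m s' => Inv (Finset.univ.filter fun v => (v : ℕ) < m) s') (by simpa using empty)
    fun m hm s' fr h => by
      have := step _ ⟨m, hm⟩ (by simp) s' fr h
      convert this using 1
      ext v
      simp [Fin.ext_iff, Nat.le_iff_lt_or_eq, or_comm]
  simpa using this

end FinLoop

end Language

/-! ### Compilation to the random access machine -/

section Compilation

/-- An assignment of machine storage to variables and arrays: variables live in registers below
`base`, register `base` holds the length `N` of the input, registers above `base` are scratch
space, and cell `i` of the array `a` lives at the address `N + (8 * i + slot a)`. -/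
structure Layout (X A : Type*) where
  base : ℕ
  reg : X → ℕ
  slot : A → ℕ
  reg_injective : Function.Injective reg
  reg_lt : ∀ x, reg x < base
  slot_injective : Function.Injective slot
  slot_lt : ∀ a, slot a < 8

variable {X A : Type*}

/-- Code that turns an index in register `t` into the address of the cell of `a`. -/
def Layout.address (L : Layout X A) (a : A) (t : ℕ) : Prog :=
  .seq (.add t t t) (.seq (.add t t t) (.seq (.add t t t) (.seq (.const (t + 1) (L.slot a))
    (.seq (.add t t (t + 1)) (.add t t L.base)))))

/-- Code that leaves the value of an expression in register `t` and uses no scratch registers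
below `t`. -/
def Expr.compile (L : Layout X A) : Expr X A → ℕ → Prog
  | .lit c, t => .const t c
  | .var x, t => .move t (L.reg x)
  | .add e f, t => .seq (e.compile L t) (.seq (f.compile L (t + 1)) (.add t t (t + 1)))
  | .sub e f, t => .seq (e.compile L t) (.seq (f.compile L (t + 1)) (.sub t t (t + 1)))
  | .get a e, t => .seq (e.compile L t) (.seq (L.address a t) (.load t t))
  | .inp e, t => .seq (e.compile L t) (.seq (.sub (t + 1) L.base t)
      (.ite (t + 1) (.load t t) (.const t 0)))

/-- The loop of the compiled program: register `t` holds the number of passes still to be made,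
register `t + 1` the number of passes made. -/
def countedLoop (i t : ℕ) (p : Prog) : Prog :=
  .loop t (.seq (.move i (t + 1)) (.seq p
    (.seq (.const (t + 2) 1) (.seq (.add (t + 1) (t + 1) (t + 2)) (.sub t t (t + 2))))))

/-- Code for a statement that uses no scratch registers below `t`. -/
def Stmt.compile (L : Layout X A) : Stmt X A → ℕ → Prog
  | .skip, _ => .skip
  | .set x e, t => .seq (e.compile L t) (.move (L.reg x) t)
  | .put a e f, t => .seq (e.compile L t) (.seq (L.address a t)
      (.seq (f.compile L (t + 1)) (.store t (t + 1))))
  | .seq p q, t => .seq (p.compile L t) (q.compile L t)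
  | .ite e p q, t => .seq (e.compile L t) (.ite t (p.compile L t) (q.compile L t))
  | .loop i x p, t => .seq (.move t (L.reg x)) (.seq (.const (t + 1) 0)
      (countedLoop (L.reg i) t (p.compile L (t + 2))))

/-- The running time of the code for an expression. -/
def Expr.cost : Expr X A → ℕ
  | .lit _ => 1
  | .var _ => 1
  | .add e f => e.cost + f.cost + 1
  | .sub e f => e.cost + f.cost + 1
  | .get _ e => e.cost + 7
  | .inp e => e.cost + 3

/-- The running time of the code for a statement. -/
def Stmt.time [DecidableEq X] [DecidableEq A] (M : ℕ → ℕ) : Stmt X A → Env X A → ℕ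
  | .skip, _ => 1
  | .set _ e, _ => e.cost + 1
  | .put _ e f, _ => e.cost + (6 + (f.cost + 1))
  | .seq p q, s => p.time M s + q.time M (p.eval M s)
  | .ite e p q, s => e.cost + ((if e.eval M s ≠ 0 then p.time M s else q.time M s) + 1)
  | .loop i x p, s => 1 + (1 + (∑ l ∈ Finset.range (s.var x),
      (1 + (p.time M ((repeatFor i (p.eval M) l s).set i l) + 3) + 1) + 1))

/-- The machine state `s` represents the environment `e`, behind an input `M` of `N` cells. -/
structure Represents (L : Layout X A) (M : ℕ → ℕ) (N : ℕ) (s : State) (e : Env X A) : Prop where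
  var : ∀ x, s.reg (L.reg x) = e.var x
  base : s.reg L.base = N
  arr : ∀ a i, s.mem (N + (8 * i + L.slot a)) = e.arr a i
  inp : ∀ i < N, s.mem i = M i
  inp_zero : ∀ i, N ≤ i → M i = 0

variable {L : Layout X A} {M : ℕ → ℕ} {N : ℕ}

namespace Represents

variable {s s' : State} {e : Env X A}

theorem congr (h : Represents L M N s e) (hm : s'.mem = s.mem)
    (hr : ∀ r ≤ L.base, s'.reg r = s.reg r) : Represents L M N s' e where
  var x := by rw [hr _ (L.reg_lt x).le, h.var]
  base := by rw [hr _ le_rfl, h.base]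
  arr a i := by rw [hm, h.arr]
  inp i hi := by rw [hm, h.inp i hi]
  inp_zero := h.inp_zero

theorem set [DecidableEq X] (h : Represents L M N s e) (x : X) (v : ℕ) :
    Represents L M N (s.setReg (L.reg x) v) (e.set x v) where
  var y := by
    simp only [State.setReg, Env.set, Function.update_apply, L.reg_injective.eq_iff, h.var]
  base := by simp [State.setReg, h.base, (L.reg_lt x).ne']
  arr := h.arr
  inp := h.inp
  inp_zero := h.inp_zero

theorem put [DecidableEq A] (h : Represents L M N s e) (a : A) (i v : ℕ) :
    Represents L M N (s.setMem (N + (8 * i + L.slot a)) v) (e.put a i v) where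
  var := h.var
  base := h.base
  arr b j := by
    have haddr : N + (8 * j + L.slot b) = N + (8 * i + L.slot a) ↔ b = a ∧ j = i := by
      have := L.slot_lt a
      have := L.slot_lt b
      rw [← L.slot_injective.eq_iff]
      omega
    simp only [State.setMem, Env.put_arr, Function.update_apply, haddr, h.arr]
  inp j hj := by
    have : j ≠ N + (8 * i + L.slot a) := by omega
    simp [State.setMem, this, h.inp j hj]
  inp_zero := h.inp_zero

end Represents

/-- Started in `s`, the program `q` halts in `s'` after `T` steps with the value `v` in register
`t`, and it changes neither the memory nor the registers below `t`. -/
structure Evaluates (q : Prog) (t v T : ℕ) (s s' : State) : Prop where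
  exec : Exec q s s' T
  mem : s'.mem = s.mem
  value : s'.reg t = v
  below : ∀ r < t, s'.reg r = s.reg r

theorem Represents.of_evaluates {q : Prog} {t v T : ℕ} {s s' : State} {env : Env X A}
    (h : Represents L M N s env) (ht : L.base < t) (hq : Evaluates q t v T s s') :
    Represents L M N s' env :=
  h.congr hq.mem fun r hr => hq.below r (by omega)

theorem Evaluates.binary {q q' o : Prog} {t v v' T T' : ℕ} {s s' s'' : State} {f : ℕ → ℕ → ℕ}
    (h : Evaluates q t v T s s') (h' : Evaluates q' (t + 1) v' T' s' s'')
    (ho : ∀ s, Exec o s (s.setReg t (f (s.reg t) (s.reg (t + 1)))) 1) :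
    Evaluates (.seq q (.seq q' o)) t (f v v') (T + (T' + 1)) s (s''.setReg t (f v v')) where
  exec := by
    have := ho s''
    rw [h'.below t (by omega), h.value, h'.value] at this
    exact .seq h.exec (.seq h'.exec this)
  mem := h'.mem.trans h.mem
  value := by simp [State.setReg]
  below r hr := by simp [State.setReg, hr.ne, h'.below r (by omega), h.below r hr]

theorem Layout.evaluates_address (L : Layout X A) (a : A) {t : ℕ} (ht : L.base < t) (s : State) :
    ∃ s', Evaluates (L.address a t) t (s.reg L.base + (8 * s.reg t + L.slot a)) 6 s s' := by
  have ht₁ : L.base ≠ t := by omega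
  have ht₂ : L.base ≠ t + 1 := by omega
  refine ⟨_, .seq (.add _ _ _ _) (.seq (.add _ _ _ _) (.seq (.add _ _ _ _)
    (.seq (.const _ _ _) (.seq (.add _ _ _ _) (.add _ _ _ _))))), rfl, ?_, fun r hr => ?_⟩
  · simp only [State.setReg, Function.update_self, Function.update_of_ne, ne_eq, ht₁, ht₂,
      not_false_eq_true, one_ne_zero, Nat.left_eq_add]
    ring
  · have hr₁ : r ≠ t := by omega
    have hr₂ : r ≠ t + 1 := by omega
    simp [State.setReg, hr₁, hr₂]

theorem Expr.evaluates_compile_inp {e : Expr X A} {env : Env X A} {t : ℕ} (ht : L.base < t)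
    {s s₁ : State} (h : Represents L M N s env)
    (h₁ : Evaluates (e.compile L t) t (e.eval M env) e.cost s s₁) :
    ∃ s', Evaluates ((Expr.inp e).compile L t) t (M (e.eval M env)) (e.cost + 3) s s' := by
  have hbase : s₁.reg L.base = N := by rw [h₁.below _ ht, h.base]
  have hbelow : ∀ v w, ∀ r < t, ((s₁.setReg (t + 1) v).setReg t w).reg r = s.reg r := by
    intro v w r hr
    have hr' : r ≠ t + 1 := by omega
    simp [State.setReg, hr.ne, hr', h₁.below r hr]
  by_cases hlt : e.eval M env < N
  · refine ⟨_, .seq h₁.exec (.seq (.sub _ _ _ _) (.ite_true ?_ (.load _ _ _))), h₁.mem, ?_,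
      hbelow _ _⟩
    · simpa [State.setReg, hbase, h₁.value, Nat.sub_eq_zero_iff_le] using hlt
    · simp [State.setReg, h₁.value, h₁.mem, h.inp _ hlt]
  · refine ⟨_, .seq h₁.exec (.seq (.sub _ _ _ _) (.ite_false ?_ (.const _ _ _))), h₁.mem, ?_,
      hbelow _ _⟩
    · simpa [State.setReg, hbase, h₁.value, Nat.sub_eq_zero_iff_le] using hlt
    · simp [State.setReg, h.inp_zero _ (not_lt.1 hlt)]

theorem Expr.evaluates_compile (e : Expr X A) {env : Env X A} {t : ℕ} (ht : L.base < t)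
    {s : State} (h : Represents L M N s env) :
    ∃ s', Evaluates (e.compile L t) t (e.eval M env) e.cost s s' := by
  induction e generalizing t s with
  | lit c =>
    exact ⟨_, .const _ _ _, rfl, by simp [State.setReg, Expr.eval],
      fun r hr => by simp [State.setReg, hr.ne]⟩
  | var x =>
    exact ⟨_, .move _ _ _, rfl, by simp [State.setReg, Expr.eval, h.var],
      fun r hr => by simp [State.setReg, hr.ne]⟩
  | add e f ihe ihf =>
    obtain ⟨s₁, h₁⟩ := ihe ht h
    obtain ⟨s₂, h₂⟩ := ihf (t := t + 1) (by omega) (h.of_evaluates ht h₁)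
    exact ⟨_, h₁.binary h₂ (.add t t (t + 1))⟩
  | sub e f ihe ihf =>
    obtain ⟨s₁, h₁⟩ := ihe ht h
    obtain ⟨s₂, h₂⟩ := ihf (t := t + 1) (by omega) (h.of_evaluates ht h₁)
    exact ⟨_, h₁.binary h₂ (.sub t t (t + 1))⟩
  | get a e ih =>
    obtain ⟨s₁, h₁⟩ := ih ht h
    obtain ⟨s₂, h₂⟩ := L.evaluates_address a ht s₁
    refine ⟨_, .seq h₁.exec (.seq h₂.exec (.load _ _ _)), h₂.mem.trans h₁.mem, ?_, fun r hr => ?_⟩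
    · simp only [State.setReg, Function.update_self, Expr.eval]
      rw [h₂.value, h₂.mem, h₁.mem, h₁.value, h₁.below _ ht, h.base, h.arr]
    · simp [State.setReg, hr.ne, h₂.below r hr, h₁.below r hr]
  | inp e ih =>
    obtain ⟨s₁, h₁⟩ := ih ht h
    exact evaluates_compile_inp ht h h₁

/-- The program `q` performs the environment transformation `f` in time `T` on every state that
represents an environment, and it preserves the scratch registers below `t`. -/
def Simulates (L : Layout X A) (M : ℕ → ℕ) (N : ℕ) (q : Prog) (t : ℕ) (f : Env X A → Env X A)
    (T : Env X A → ℕ) : Prop :=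
  ∀ s e, Represents L M N s e → ∃ s', Exec q s s' (T e) ∧ Represents L M N s' (f e) ∧
    ∀ r, L.base < r → r < t → s'.reg r = s.reg r

theorem Exec.loop_of_invariant {x m : ℕ} {p : Prog} {c : ℕ → ℕ} (Inv : ℕ → State → Prop)
    (hx : ∀ l s, Inv l s → s.reg x = m - l)
    (step : ∀ l < m, ∀ s, Inv l s → ∃ s', Exec p s s' (c l) ∧ Inv (l + 1) s')
    {s : State} (zero : Inv 0 s) :
    ∃ s', Exec (.loop x p) s s' (∑ l ∈ Finset.range m, (c l + 1) + 1) ∧ Inv m s' := by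
  have key : ∀ k ≤ m, ∀ s, Inv (m - k) s →
      ∃ s', Exec (.loop x p) s s' (∑ l ∈ Finset.Ico (m - k) m, (c l + 1) + 1) ∧ Inv m s' := by
    intro k
    induction k with
    | zero => exact fun _ s h => ⟨s, by simpa using Exec.loop_done (by simpa using hx _ s h), h⟩
    | succ k ih =>
      intro hk s h
      obtain ⟨s₁, x₁, h₁⟩ := step _ (by omega) s h
      rw [show m - (k + 1) + 1 = m - k by omega] at h₁
      obtain ⟨s', x', h'⟩ := ih (by omega) s₁ h₁
      refine ⟨s', ?_, h'⟩
      rw [Finset.sum_eq_sum_Ico_succ_bot (by omega), show m - (k + 1) + 1 = m - k by omega]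
      have hne : s.reg x ≠ 0 := by rw [hx _ s h]; omega
      convert Exec.loop_step hne x₁ x' using 1
      ring
  have := key m le_rfl s (by simpa using zero)
  rwa [Nat.sub_self, ← Finset.range_eq_Ico] at this

namespace Simulates

variable {q q' : Prog} {t : ℕ} {f f' : Env X A → Env X A} {T T' : Env X A → ℕ}

theorem seq (h : Simulates L M N q t f T) (h' : Simulates L M N q' t f' T') :
    Simulates L M N (.seq q q') t (fun e => f' (f e)) fun e => T e + T' (f e) := by
  intro s e hs
  obtain ⟨s₁, x₁, h₁, r₁⟩ := h s e hs
  obtain ⟨s₂, x₂, h₂, r₂⟩ := h' s₁ _ h₁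
  exact ⟨s₂, .seq x₁ x₂, h₂, fun r hr hrt => (r₂ r hr hrt).trans (r₁ r hr hrt)⟩

theorem set [DecidableEq X] (e : Expr X A) (ht : L.base < t) (x : X) :
    Simulates L M N (.seq (e.compile L t) (.move (L.reg x) t)) t
      (fun env => env.set x (e.eval M env)) fun _ => e.cost + 1 := by
  intro s env hs
  obtain ⟨s₁, h₁⟩ := e.evaluates_compile ht hs
  refine ⟨_, .seq h₁.exec (.move _ _ _), ?_, fun r hr hrt => ?_⟩
  · rw [h₁.value]
    exact (hs.of_evaluates ht h₁).set x _
  · have hne : r ≠ L.reg x := by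
      have := L.reg_lt x
      omega
    simp [State.setReg, hne, h₁.below r hrt]

theorem put [DecidableEq A] (e e' : Expr X A) (ht : L.base < t) (a : A) :
    Simulates L M N (.seq (e.compile L t) (.seq (L.address a t)
        (.seq (e'.compile L (t + 1)) (.store t (t + 1))))) t
      (fun env => env.put a (e.eval M env) (e'.eval M env))
      fun _ => e.cost + (6 + (e'.cost + 1)) := by
  intro s env hs
  obtain ⟨s₁, h₁⟩ := e.evaluates_compile ht hs
  have hs₁ := hs.of_evaluates ht h₁
  obtain ⟨s₂, h₂⟩ := L.evaluates_address a ht s₁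
  have hs₂ := hs₁.of_evaluates ht h₂
  obtain ⟨s₃, h₃⟩ := e'.evaluates_compile (t := t + 1) (by omega) hs₂
  refine ⟨_, .seq h₁.exec (.seq h₂.exec (.seq h₃.exec (.store _ _ _))), ?_, fun r _ hrt => ?_⟩
  · rw [h₃.value, h₃.below t (by omega), h₂.value, hs₁.base, h₁.value]
    exact (hs₂.of_evaluates (by omega) h₃).put a _ _
  · exact (h₃.below r (by omega)).trans ((h₂.below r hrt).trans (h₁.below r hrt))

theorem ite (e : Expr X A) (ht : L.base < t) (h : Simulates L M N q t f T)
    (h' : Simulates L M N q' t f' T') :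
    Simulates L M N (.seq (e.compile L t) (.ite t q q')) t
      (fun env => if e.eval M env ≠ 0 then f env else f' env)
      fun env => e.cost + ((if e.eval M env ≠ 0 then T env else T' env) + 1) := by
  intro s env hs
  obtain ⟨s₁, h₁⟩ := e.evaluates_compile ht hs
  have hs₁ := hs.of_evaluates ht h₁
  by_cases hv : e.eval M env = 0
  · obtain ⟨s₂, x₂, h₂, r₂⟩ := h' s₁ env hs₁
    refine ⟨s₂, ?_, by simpa [hv] using h₂, fun r hr hrt =>
      (r₂ r hr hrt).trans (h₁.below r hrt)⟩
    simpa [hv] using Exec.seq h₁.exec (.ite_false (h₁.value.trans hv) x₂)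
  · obtain ⟨s₂, x₂, h₂, r₂⟩ := h s₁ env hs₁
    refine ⟨s₂, ?_, by simpa [hv] using h₂, fun r hr hrt =>
      (r₂ r hr hrt).trans (h₁.below r hrt)⟩
    simpa [hv] using Exec.seq h₁.exec (.ite_true (h₁.value.trans_ne hv) x₂)

theorem countedLoop [DecidableEq X] (h : Simulates L M N q (t + 2) f T) (ht : L.base < t) (i : X)
    {m : ℕ} {s : State} {e : Env X A} (hs : Represents L M N s e) (hm : s.reg t = m)
    (hzero : s.reg (t + 1) = 0) :
    ∃ s', Exec (countedLoop (L.reg i) t q) s s' (∑ l ∈ Finset.range m,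
        (1 + (T ((repeatFor i f l e).set i l) + 3) + 1) + 1) ∧
      Represents L M N s' (repeatFor i f m e) ∧
      ∀ r, L.base < r → r < t → s'.reg r = s.reg r := by
  have hi := L.reg_lt i
  have := Exec.loop_of_invariant (x := t) (m := m) (s := s)
    (p := .seq (.move (L.reg i) (t + 1)) (.seq q
      (.seq (.const (t + 2) 1) (.seq (.add (t + 1) (t + 1) (t + 2)) (.sub t t (t + 2))))))
    (c := fun l => 1 + (T ((repeatFor i f l e).set i l) + 3))
    (fun l s' => s'.reg t = m - l ∧ s'.reg (t + 1) = l ∧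
      Represents L M N s' (repeatFor i f l e) ∧ ∀ r, L.base < r → r < t → s'.reg r = s.reg r)
    (fun _ _ h => h.1) ?_ ⟨by simpa using hm, hzero, hs, fun _ _ _ => rfl⟩
  · obtain ⟨s', x', -, -, h'⟩ := this
    exact ⟨s', x', h'⟩
  rintro l - s₁ ⟨c₁, c₂, h₁, r₁⟩
  obtain ⟨s₂, x₂, h₂, r₂⟩ := h _ _ (h₁.set i l)
  have hkeep : ∀ r, L.base < r → r < t + 2 → s₂.reg r = s₁.reg r := fun r hr hrt => by
    simpa [State.setReg, show r ≠ L.reg i by omega] using r₂ r hr hrt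
  have x₁ : Exec (.move (L.reg i) (t + 1)) s₁ (s₁.setReg (L.reg i) l) 1 := c₂ ▸ .move _ _ _
  refine ⟨_, .seq x₁ (.seq x₂ (.seq (.const _ _ _) (.seq (.add _ _ _ _)
    (.sub _ _ _ _)))), ?_, ?_, h₂.congr rfl fun r hr => ?_, fun r hr hrt => ?_⟩
  · simp [State.setReg, hkeep t ht (by omega), c₁]
    omega
  · simp [State.setReg, hkeep (t + 1) (by omega) (by omega), c₂]
  · simp [State.setReg, show r ≠ t by omega, show r ≠ t + 1 by omega, show r ≠ t + 2 by omega]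
  · simp [State.setReg, show r ≠ t by omega, show r ≠ t + 1 by omega, show r ≠ t + 2 by omega,
      hkeep r hr (by omega), r₁ r hr hrt]

theorem loop [DecidableEq X] (h : Simulates L M N q (t + 2) f T) (ht : L.base < t) (i x : X) :
    Simulates L M N (.seq (.move t (L.reg x)) (.seq (.const (t + 1) 0)
        (RAM.countedLoop (L.reg i) t q))) t
      (fun e => repeatFor i f (e.var x) e)
      fun e => 1 + (1 + (∑ l ∈ Finset.range (e.var x),
        (1 + (T ((repeatFor i f l e).set i l) + 3) + 1) + 1)) := by
  intro s e hs
  set s₁ := (s.setReg t (s.reg (L.reg x))).setReg (t + 1) 0 with hs₁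
  have hkeep : ∀ r < t, s₁.reg r = s.reg r := fun r hr => by
    simp [hs₁, State.setReg, show r ≠ t by omega, show r ≠ t + 1 by omega]
  obtain ⟨s', x', h', r'⟩ := h.countedLoop ht i (m := e.var x) (s := s₁)
    (hs.congr rfl fun r hr => hkeep r (by omega)) (by simp [hs₁, State.setReg, hs.var])
    (by simp [hs₁, State.setReg])
  exact ⟨s', .seq (.move _ _ _) (.seq (.const _ _ _) x'), h',
    fun r hr hrt => (r' r hr hrt).trans (hkeep r hrt)⟩

end Simulates

theorem Stmt.simulates_compile [DecidableEq X] [DecidableEq A] (p : Stmt X A) {t : ℕ}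
    (ht : L.base < t) : Simulates L M N (p.compile L t) t (p.eval M) (p.time M) := by
  induction p generalizing t with
  | skip => exact fun s _ hs => ⟨s, .skip s, hs, fun _ _ _ => rfl⟩
  | set x e => exact .set e ht x
  | put a e f => exact .put e f ht a
  | seq p q ihp ihq => exact (ihp ht).seq (ihq ht)
  | ite e p q ihp ihq => exact .ite e ht (ihp ht) (ihq ht)
  | loop i x p ih => exact (ih (t := t + 2) (by omega)).loop ht i x

/-! ### Running times -/

/-- Every loop bound of the statement is one of the variables in `B`. -/
def Stmt.boundsIn [DecidableEq X] (B : Finset X) : Stmt X A → Bool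
  | .skip => true
  | .set _ _ => true
  | .put _ _ _ => true
  | .seq p q => p.boundsIn B && q.boundsIn B
  | .ite _ p q => p.boundsIn B && q.boundsIn B
  | .loop _ x p => x ∈ B && p.boundsIn B

/-- Time bound for a statement all of whose loops run at most `m` times. -/
def Stmt.cost (m : ℕ) : Stmt X A → ℕ
  | .skip => 1
  | .set _ e => e.cost + 1
  | .put _ e f => e.cost + f.cost + 7
  | .seq p q => p.cost m + q.cost m
  | .ite e p q => e.cost + p.cost m + q.cost m + 1
  | .loop _ _ p => m * (p.cost m + 5) + 3

theorem Stmt.time_le_cost [DecidableEq X] [DecidableEq A] {p : Stmt X A} {B : Finset X} {m : ℕ}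
    (hp : p.boundsIn B) (hw : ∀ x ∈ B, p.writes x = false) {s : Env X A}
    (hs : ∀ x ∈ B, s.var x ≤ m) : p.time M s ≤ p.cost m := by
  induction p generalizing s with
  | skip => exact le_rfl
  | set x e => exact le_rfl
  | put a e f => exact le_of_eq (by simp only [Stmt.time, Stmt.cost]; ring)
  | seq p q ihp ihq =>
    simp only [Stmt.boundsIn, Bool.and_eq_true] at hp
    simp only [Stmt.writes, Bool.or_eq_false_iff] at hw
    exact Nat.add_le_add (ihp hp.1 (fun x hx => (hw x hx).1) hs)
      (ihq hp.2 (fun x hx => (hw x hx).2) fun x hx => by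
        rw [Stmt.eval_var (hw x hx).1]
        exact hs x hx)
  | ite e p q ihp ihq =>
    simp only [Stmt.boundsIn, Bool.and_eq_true] at hp
    simp only [Stmt.writes, Bool.or_eq_false_iff] at hw
    have hp' := ihp hp.1 (fun x hx => (hw x hx).1) hs
    have hq' := ihq hp.2 (fun x hx => (hw x hx).2) hs
    simp only [Stmt.time, Stmt.cost]
    split_ifs <;> omega
  | loop i y p ih =>
    simp only [Stmt.boundsIn, Bool.and_eq_true, decide_eq_true_eq] at hp
    have hpass : ∀ l ∈ Finset.range (s.var y),
        1 + (p.time M ((repeatFor i (p.eval M) l s).set i l) + 3) + 1 ≤ p.cost m + 5 := by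
      intro l _
      have hframe := Stmt.frame_repeatFor (i := i) (x := y) (p.frame_eval M) l s
      have hw' := hw
      simp only [Stmt.writes, Bool.or_eq_false_iff, decide_eq_false_iff_not] at hw'
      have := ih hp.2 (fun x hx => (hw' x hx).2) (s := (repeatFor i (p.eval M) l s).set i l)
        fun x hx => by
          rw [Env.set_var, if_neg (hw' x hx).1, hframe.var x (hw x hx)]
          exact hs x hx
      omega
    have hsum := (Finset.sum_le_card_nsmul _ _ _ hpass).trans
      (Nat.mul_le_mul_right _ ((Finset.card_range _).trans_le (hs y hp.1)))
    simp only [Stmt.time, Stmt.cost]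
    omega

theorem Stmt.cost_le (p : Stmt X A) : ∃ K D : ℕ, ∀ m, p.cost m ≤ K * (m + 1) ^ D := by
  have pos : ∀ m D : ℕ, 1 ≤ (m + 1) ^ D := fun m D => Nat.one_le_pow _ _ m.succ_pos
  induction p with
  | skip => exact ⟨1, 0, fun m => by simp [Stmt.cost]⟩
  | set x e => exact ⟨e.cost + 1, 0, fun m => by simp [Stmt.cost]⟩
  | put a e f => exact ⟨e.cost + f.cost + 7, 0, fun m => by simp [Stmt.cost]⟩
  | seq p q ihp ihq =>
    obtain ⟨K, D, h⟩ := ihp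
    obtain ⟨K', D', h'⟩ := ihq
    refine ⟨K + K', D + D', fun m => ?_⟩
    calc p.cost m + q.cost m ≤ K * (m + 1) ^ D * 1 + 1 * (K' * (m + 1) ^ D') := by
          simpa using Nat.add_le_add (h m) (h' m)
      _ ≤ K * (m + 1) ^ D * (m + 1) ^ D' + (m + 1) ^ D * (K' * (m + 1) ^ D') := by
          gcongr <;> exact pos m _
      _ = (K + K') * (m + 1) ^ (D + D') := by ring
  | ite e p q ihp ihq =>
    obtain ⟨K, D, h⟩ := ihp
    obtain ⟨K', D', h'⟩ := ihq
    refine ⟨e.cost + 1 + K + K', D + D', fun m => ?_⟩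
    calc e.cost + p.cost m + q.cost m + 1
        ≤ (e.cost + 1) * (1 * 1) + K * (m + 1) ^ D * 1 + 1 * (K' * (m + 1) ^ D') := by
          have := h m
          have := h' m
          omega
      _ ≤ (e.cost + 1) * ((m + 1) ^ D * (m + 1) ^ D') + K * (m + 1) ^ D * (m + 1) ^ D' +
            (m + 1) ^ D * (K' * (m + 1) ^ D') := by
          gcongr <;> exact pos m _
      _ = (e.cost + 1 + K + K') * (m + 1) ^ (D + D') := by ring
  | loop i x p ih =>
    obtain ⟨K, D, h⟩ := ih
    refine ⟨K + 8, D + 1, fun m => ?_⟩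
    calc m * (p.cost m + 5) + 3 ≤ (m + 1) * (p.cost m + 8 * 1) := by linarith
      _ ≤ (m + 1) * (K * (m + 1) ^ D + 8 * (m + 1) ^ D) := by
          gcongr
          exacts [h m, pos m D]
      _ = (K + 8) * (m + 1) ^ (D + 1) := by ring

end Compilation

end RAM

namespace MaxMinFVS

open SimpleGraph RAM

/-! ### Induced forests -/

section InducedForests

variable {V : Type*} {G : SimpleGraph V} {F F' : Finset V} {v a b : V}

/-- The edges of `G` with both ends in `F`, as a graph on all vertices. -/
def within (G : SimpleGraph V) (F : Finset V) : SimpleGraph V where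
  Adj u v := G.Adj u v ∧ u ∈ F ∧ v ∈ F
  symm := ⟨fun _ _ h => ⟨h.1.symm, h.2.2, h.2.1⟩⟩
  loopless := ⟨fun _ h => h.1.ne rfl⟩

/-- The vertex set `F` induces a forest. -/
def IsForest (G : SimpleGraph V) (F : Finset V) : Prop := (within G F).IsAcyclic

/-- The vertices `a` and `b` are distinct neighbours of `v` in the same tree of the forest `F`, so
that adding `v` to `F` closes a cycle. -/
structure Blocks (G : SimpleGraph V) (F : Finset V) (v a b : V) : Prop where
  left_mem : a ∈ F
  right_mem : b ∈ F
  ne : a ≠ b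
  adj_left : G.Adj v a
  adj_right : G.Adj v b
  reachable : (within G F).Reachable a b

/-- `F` is an inclusion-maximal induced forest. -/
def IsMaxForest [DecidableEq V] (G : SimpleGraph V) (F : Finset V) : Prop :=
  IsForest G F ∧ ∀ v ∉ F, ¬ IsForest G (insert v F)

theorem within_mono (h : F ⊆ F') : within G F ≤ within G F' :=
  fun _ _ hab => ⟨hab.1, h hab.2.1, h hab.2.2⟩

theorem IsForest.mono (h : IsForest G F') (hs : F ⊆ F') : IsForest G F :=
  IsAcyclic.anti (within_mono hs) h

theorem isForest_empty : IsForest G ∅ := by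
  have : within G ∅ = ⊥ := by
    ext a b
    simp [within]
  rw [IsForest, this]
  exact isAcyclic_bot

theorem mem_of_mem_support_within {u w x : V} {p : (within G F).Walk u w} (hp : ¬ p.Nil)
    (hx : x ∈ p.support) : x ∈ F := by
  obtain ⟨e, he, hxe⟩ := (Walk.mem_support_iff_exists_mem_edges_of_not_nil hp).1 hx
  induction e with
  | h a b =>
    obtain ⟨-, ha, hb⟩ := p.adj_of_mem_edges he
    rcases Sym2.mem_iff.1 hxe with rfl | rfl
    exacts [ha, hb]

theorem isForest_iff_isAcyclic_induce : IsForest G F ↔ (G.induce (F : Set V)).IsAcyclic := by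
  refine ⟨fun h => IsAcyclic.comap (G := G.induce (F : Set V)) (G' := within G F)
    ⟨Subtype.val, fun {a b} hab => ⟨hab, a.2, b.2⟩⟩ Subtype.val_injective h, fun h v p hp => ?_⟩
  have hle : within G F ≤ G := fun _ _ hab => hab.1
  have hsupp : ∀ x ∈ (p.mapLe hle).support, x ∈ (F : Set V) := by
    simpa using fun x hx => mem_of_mem_support_within hp.not_nil hx
  refine h ((p.mapLe hle).induce _ hsupp)
    (Walk.IsCycle.of_map (f := (Embedding.induce _).toHom) ?_)
  rw [Walk.map_induce]
  exact hp.mapLe hle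

variable [DecidableEq V]

theorem Blocks.not_isForest_insert (h : Blocks G F v a b) (hv : v ∉ F) :
    ¬ IsForest G (insert v F) := by
  obtain ⟨ha, hb, hab, hva, hvb, hr⟩ := h
  intro hF
  have hbridge := isAcyclic_iff_forall_adj_isBridge.1 hF
    (v := v) (w := a) ⟨hva, by simp, by simp [ha]⟩
  rw [isBridge_iff] at hbridge
  apply hbridge
  have hvb' : ((within G (insert v F)).deleteEdges {s(v, a)}).Adj v b := by
    rw [deleteEdges_adj]
    refine ⟨⟨hvb, by simp, by simp [hb]⟩, ?_⟩
    simp [hab.symm, hva.ne]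
  have hle : within G F ≤ (within G (insert v F)).deleteEdges {s(v, a)} := by
    intro x y hxy
    rw [deleteEdges_adj]
    refine ⟨within_mono (Finset.subset_insert _ _) hxy, ?_⟩
    simp only [Set.mem_singleton_iff, Sym2.eq_iff]
    rintro (⟨rfl, rfl⟩ | ⟨rfl, rfl⟩)
    exacts [hv hxy.2.1, hv hxy.2.2]
  exact hvb'.reachable.trans (hr.mono hle).symm

theorem edges_subset_within_of_notMem_support {x y : V} {p : (within G (insert v F)).Walk x y}
    (hv : v ∉ p.support) : ∀ e ∈ p.edges, e ∈ (within G F).edgeSet := by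
  intro e he
  induction e with
  | h a b =>
    have hab := p.adj_of_mem_edges he
    have ha := p.fst_mem_support_of_mem_edges he
    have hb := p.snd_mem_support_of_mem_edges he
    exact ⟨hab.1, (Finset.mem_insert.1 hab.2.1).resolve_left fun h => hv (h ▸ ha),
      (Finset.mem_insert.1 hab.2.2).resolve_left fun h => hv (h ▸ hb)⟩

theorem exists_blocks_of_isCycle {c : (within G (insert v F)).Walk v v} (hc : c.IsCycle) :
    ∃ a b, Blocks G F v a b := by
  cases c with
  | nil => exact absurd .nil hc.not_nil
  | @cons _ a _ hva q =>
    obtain ⟨hq, hne⟩ := (Walk.cons_isCycle_iff _ _).1 hc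
    have hpath := hq.reverse
    have hedge : s(v, a) ∉ q.reverse.edges := by simpa using hne
    cases hr : q.reverse with
    | nil => exact absurd rfl hva.1.ne
    | @cons _ b _ hvb r =>
      rw [hr] at hpath hedge
      have hvr := ((Walk.cons_isPath_iff _ _).1 hpath).2
      have hab : a ≠ b := by
        rintro rfl
        simp at hedge
      exact ⟨a, b, (Finset.mem_insert.1 hva.2.2).resolve_left hva.1.ne',
        (Finset.mem_insert.1 hvb.2.2).resolve_left hvb.1.ne', hab, hva.1, hvb.1,
        (r.transfer _ (edges_subset_within_of_notMem_support hvr)).reachable.symm⟩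

theorem IsForest.insert (hF : IsForest G F) (h : ∀ a b, ¬ Blocks G F v a b) :
    IsForest G (insert v F) := by
  intro x p hp
  by_cases hvp : v ∈ p.support
  · obtain ⟨a, b, hab⟩ := exists_blocks_of_isCycle (hp.rotate hvp)
    exact h a b hab
  · exact hF _ (hp.transfer (edges_subset_within_of_notMem_support hvp))

theorem IsMaxForest.exists_blocks (hF : IsMaxForest G F) (hv : v ∉ F) :
    ∃ a b, Blocks G F v a b := by
  by_contra! h
  exact hF.2 v hv (hF.1.insert h)

omit [DecidableEq V] in
theorem IsForest.eq_of_adj_of_adj {u : V} (hF : IsForest G F) (hu : u ∈ F) (hv : v ∈ F)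
    (ha : a ∈ F) (hb : b ∈ F) (hab : a ≠ b) (hua : G.Adj u a) (hub : G.Adj u b)
    (hva : G.Adj v a) (hvb : G.Adj v b) : u = v := by
  classical
  by_contra huv
  have ha' : a ∈ F.erase v := Finset.mem_erase.2 ⟨hva.ne', ha⟩
  have hb' : b ∈ F.erase v := Finset.mem_erase.2 ⟨hvb.ne', hb⟩
  have hu' : u ∈ F.erase v := Finset.mem_erase.2 ⟨huv, hu⟩
  have hau : (within G (F.erase v)).Adj a u := ⟨hua.symm, ha', hu'⟩
  have hub : (within G (F.erase v)).Adj u b := ⟨hub, hu', hb'⟩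
  have hblocks : Blocks G (F.erase v) v a b :=
    ⟨ha', hb', hab, hva, hvb, hau.reachable.trans hub.reachable⟩
  exact hblocks.not_isForest_insert (Finset.notMem_erase v F) (by rwa [Finset.insert_erase hv])

theorem card_edgeFinset_le_of_isAcyclic {W : Type*} [Fintype W] {H : SimpleGraph W}
    [Fintype H.edgeSet] (hH : H.IsAcyclic) : H.edgeFinset.card ≤ Fintype.card W := by
  classical
  rcases isEmpty_or_nonempty W with hW | hW
  · have : H.edgeFinset = ∅ := Finset.eq_empty_of_isEmpty _
    simp [this]
  · obtain ⟨T, hle, -, hT⟩ :=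
      (connected_top (V := W)).exists_isTree_le_of_le_of_isAcyclic le_top hH
    calc H.edgeFinset.card ≤ T.edgeFinset.card := Finset.card_le_card (edgeFinset_mono hle)
      _ ≤ Fintype.card W := hT.card_edgeFinset ▸ Nat.le_succ _

open Classical in
theorem sum_card_adj_le_card_edgeFinset {A J : Finset V} (hAJ : Disjoint A J) :
    ∑ v ∈ J, (A.filter (G.Adj v)).card ≤
      (G.induce ((A ∪ J : Finset V) : Set V)).edgeFinset.card := by
  rw [← Finset.card_sigma]
  refine (Finset.card_le_card_of_injOn (t := Finset.image (Sym2.map Subtype.val) _)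
    (fun x => s(x.1, x.2)) ?_ ?_).trans Finset.card_image_le
  · rintro ⟨v, a⟩ hx
    simp only [Finset.coe_sigma, Set.mem_sigma_iff, Finset.mem_coe, Finset.mem_filter] at hx
    obtain ⟨hv, ha, hva⟩ := hx
    exact Finset.mem_image.2 ⟨s(⟨v, by simp [hv]⟩, ⟨a, by simp [ha]⟩), by simpa using hva, rfl⟩
  · rintro ⟨v, a⟩ hx ⟨v', a'⟩ hx' heq
    simp only [Finset.coe_sigma, Set.mem_sigma_iff, Finset.mem_coe, Finset.mem_filter] at hx hx'
    rcases Sym2.eq_iff.1 heq with ⟨rfl, rfl⟩ | ⟨rfl, rfl⟩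
    · rfl
    · exact absurd hx.1 (Finset.disjoint_left.1 hAJ hx'.2.1)

open Classical in
theorem IsForest.sum_card_adj_le {A J : Finset V} (hAJ : Disjoint A J) (hF : IsForest G (A ∪ J)) :
    ∑ v ∈ J, (A.filter (G.Adj v)).card ≤ A.card + J.card := by
  calc _ ≤ (G.induce ((A ∪ J : Finset V) : Set V)).edgeFinset.card :=
        sum_card_adj_le_card_edgeFinset hAJ
    _ ≤ Fintype.card ((A ∪ J : Finset V) : Set V) :=
        card_edgeFinset_le_of_isAcyclic (isForest_iff_isAcyclic_induce.1 hF)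
    _ = A.card + J.card := by simp [Finset.card_union_of_disjoint hAJ]

theorem isFVS_iff_isForest_compl [Fintype V] (S : Finset V) : G.IsFVS S ↔ IsForest G Sᶜ := by
  rw [isForest_iff_isAcyclic_induce, IsFVS, Finset.coe_compl]

theorem minimal_isFVS_iff [Fintype V] (S : Finset V) :
    Minimal G.IsFVS S ↔ IsMaxForest G Sᶜ := by
  have hP : ∀ ⦃s t : Finset V⦄, G.IsFVS t → t ⊆ s → G.IsFVS s := fun s t ht hts => by
    rw [isFVS_iff_isForest_compl] at ht ⊢
    exact ht.mono (Finset.compl_subset_compl.2 hts)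
  simp only [Finset.minimal_iff_forall_erase hP, isFVS_iff_isForest_compl, Finset.compl_erase,
    IsMaxForest, Finset.mem_compl, not_not]

theorem maxMinFVS_iff_exists_isMaxForest [Fintype V] (k : ℕ) :
    MaxMinFVS G k ↔ ∃ F : Finset V, IsMaxForest G F ∧ k + F.card ≤ Fintype.card V := by
  rw [MaxMinFVS, compl_surjective.exists]
  refine exists_congr fun F => ?_
  rw [minimal_isFVS_iff, compl_compl, Finset.card_compl]
  have := F.card_le_univ
  exact and_congr_right fun _ => by omega

end InducedForests

/-! ### Replacing the vertices outside a vertex cover -/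

section Replacement

variable {V : Type*} [DecidableEq V] {G : SimpleGraph V} {C F : Finset V} {u v x : V} {φ : V → V}

open Classical in
/-- The neighbours of `v` that belong to both the vertex cover `C` and the forest `F`. -/
noncomputable def coverNbrs (G : SimpleGraph V) (C F : Finset V) (v : V) : Finset V :=
  (F ∩ C).filter (G.Adj v)

/-- The vertex `v` lies outside `C` and has at most one neighbour in `F ∩ C`. -/
def IsLeaf (G : SimpleGraph V) (C F : Finset V) (v : V) : Prop :=
  v ∉ C ∧ (coverNbrs G C F v).card ≤ 1

omit [DecidableEq V] in
theorem not_adj_of_notMem (hC : G.IsVertexCover C) (hu : u ∉ C) (hv : v ∉ C) :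
    ¬ G.Adj u v :=
  fun h => (hC h).elim hu hv

theorem mem_coverNbrs : x ∈ coverNbrs G C F v ↔ (x ∈ F ∧ x ∈ C) ∧ G.Adj v x := by
  simp [coverNbrs]

theorem Blocks.left_mem_coverNbrs {a b : V} (h : Blocks G F v a b) (hC : G.IsVertexCover C)
    (hv : v ∉ C) : a ∈ coverNbrs G C F v :=
  mem_coverNbrs.2 ⟨⟨h.left_mem, (hC h.adj_left).resolve_left hv⟩, h.adj_left⟩

omit [DecidableEq V] in
theorem Blocks.symm {a b : V} (h : Blocks G F v a b) : Blocks G F v b a :=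
  ⟨h.right_mem, h.left_mem, h.ne.symm, h.adj_right, h.adj_left, h.reachable.symm⟩

theorem IsMaxForest.mem_of_isLeaf (hF : IsMaxForest G F) (hC : G.IsVertexCover C)
    (hv : IsLeaf G C F v) : v ∈ F := by
  by_contra hvF
  obtain ⟨a, b, h⟩ := hF.exists_blocks hvF
  exact hv.2.not_gt (Finset.one_lt_card.2 ⟨a, h.left_mem_coverNbrs hC hv.1, b,
    h.symm.left_mem_coverNbrs hC hv.1, h.ne⟩)

/-- The map `φ` fixes `C` and replaces vertices outside `C` by vertices outside `C` with the same
neighbours in `F ∩ C`. It moves no leaf, and every vertex of `C` outside `F` remains adjacent to the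
images of two vertices of the same tree of `F`. -/
structure IsReplacement (G : SimpleGraph V) (C F : Finset V) (φ : V → V) : Prop where
  map_of_mem : ∀ v ∈ C, φ v = v
  map_notMem : ∀ v ∉ C, φ v ∉ C
  coverNbrs_map : ∀ v ∉ C, coverNbrs G C F (φ v) = coverNbrs G C F v
  map_of_isLeaf : ∀ v, IsLeaf G C F v → φ v = v
  exists_blocks : ∀ v ∈ C, v ∉ F → ∃ a b, Blocks G F v a b ∧ G.Adj v (φ a) ∧ G.Adj v (φ b)

namespace IsReplacement

theorem map_mem_iff (hφ : IsReplacement G C F φ) : φ v ∈ C ↔ v ∈ C :=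
  ⟨fun h => by_contra fun hv => hφ.map_notMem v hv h, fun h => (hφ.map_of_mem v h).symm ▸ h⟩

theorem adj_map_iff_of_mem (hφ : IsReplacement G C F φ) (hv : v ∉ C) (hx : x ∈ F) (hxC : x ∈ C) :
    G.Adj (φ v) x ↔ G.Adj v x := by
  simpa [mem_coverNbrs, hx, hxC] using Finset.ext_iff.1 (hφ.coverNbrs_map v hv) x

theorem adj_map_iff (hφ : IsReplacement G C F φ) (hC : G.IsVertexCover C) (hu : u ∈ F)
    (hv : v ∈ F) : G.Adj (φ u) (φ v) ↔ G.Adj u v := by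
  by_cases huC : u ∈ C <;> by_cases hvC : v ∈ C
  · rw [hφ.map_of_mem u huC, hφ.map_of_mem v hvC]
  · rw [hφ.map_of_mem u huC, G.adj_comm, hφ.adj_map_iff_of_mem hvC hu huC, G.adj_comm]
  · rw [hφ.map_of_mem v hvC, hφ.adj_map_iff_of_mem huC hv hvC]
  · exact iff_of_false (not_adj_of_notMem hC (hφ.map_notMem u huC) (hφ.map_notMem v hvC))
      (not_adj_of_notMem hC huC hvC)

theorem injOn (hφ : IsReplacement G C F φ) (hF : IsForest G F) : Set.InjOn φ F := by
  intro u hu v hv huv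
  have hiff : u ∈ C ↔ v ∈ C := by rw [← hφ.map_mem_iff, huv, hφ.map_mem_iff]
  by_cases huC : u ∈ C
  · rwa [hφ.map_of_mem u huC, hφ.map_of_mem v (hiff.1 huC)] at huv
  have hvC : v ∉ C := fun h => huC (hiff.2 h)
  have hnbrs : coverNbrs G C F u = coverNbrs G C F v := by
    rw [← hφ.coverNbrs_map u huC, huv, hφ.coverNbrs_map v hvC]
  rcases le_or_gt (coverNbrs G C F u).card 1 with hleaf | hbranch
  · rwa [hφ.map_of_isLeaf u ⟨huC, hleaf⟩, hφ.map_of_isLeaf v ⟨hvC, hnbrs ▸ hleaf⟩] at huv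
  · obtain ⟨a, ha, b, hb, hab⟩ := Finset.one_lt_card.1 hbranch
    have hva := mem_coverNbrs.1 (hnbrs ▸ ha)
    have hvb := mem_coverNbrs.1 (hnbrs ▸ hb)
    exact hF.eq_of_adj_of_adj hu hv hva.1.1 hvb.1.1 hab (mem_coverNbrs.1 ha).2
      (mem_coverNbrs.1 hb).2 hva.2 hvb.2

theorem isForest_image (hφ : IsReplacement G C F φ) (hC : G.IsVertexCover C)
    (hF : IsForest G F) : IsForest G (F.image φ) := by
  rw [isForest_iff_isAcyclic_induce] at hF ⊢
  have hsurj : ∀ y : (F.image φ : Finset V), ∃ x : (F : Set V), φ x = y := by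
    rintro ⟨y, hy⟩
    obtain ⟨x, hx, rfl⟩ := Finset.mem_image.1 hy
    exact ⟨⟨x, hx⟩, rfl⟩
  choose ψ hψ using hsurj
  refine hF.comap (G := G.induce (F.image φ : Set V)) ⟨ψ, fun {a b} hab => ?_⟩ fun a b hab => ?_
  · have hadj : G.Adj (φ (ψ a)) (φ (ψ b)) := by rwa [hψ, hψ]
    exact (hφ.adj_map_iff hC (ψ a).2 (ψ b).2).1 hadj
  · have hab' : ψ a = ψ b := hab
    rw [Subtype.ext_iff, ← hψ a, ← hψ b, hab']

theorem reachable_map {a b : V} (hφ : IsReplacement G C F φ) (hC : G.IsVertexCover C)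
    (h : (within G F).Reachable a b) : (within G (F.image φ)).Reachable (φ a) (φ b) :=
  h.map (G := within G F) (G' := within G (F.image φ)) ⟨φ, fun {_ _} hxy =>
    ⟨(hφ.adj_map_iff hC hxy.2.1 hxy.2.2).2 hxy.1, Finset.mem_image_of_mem φ hxy.2.1,
      Finset.mem_image_of_mem φ hxy.2.2⟩⟩

theorem mem_image_of_mem (hφ : IsReplacement G C F φ) (hv : v ∈ F) (hvC : v ∈ C) :
    v ∈ F.image φ :=
  Finset.mem_image.2 ⟨v, hv, hφ.map_of_mem v hvC⟩

theorem blocks_image {a b : V} (hφ : IsReplacement G C F φ) (hC : G.IsVertexCover C)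
    (hF : IsForest G F) (h : Blocks G F v a b) (ha : G.Adj v (φ a)) (hb : G.Adj v (φ b)) :
    Blocks G (F.image φ) v (φ a) (φ b) where
  left_mem := Finset.mem_image_of_mem φ h.left_mem
  right_mem := Finset.mem_image_of_mem φ h.right_mem
  ne hab := h.ne (hφ.injOn hF h.left_mem h.right_mem hab)
  adj_left := ha
  adj_right := hb
  reachable := hφ.reachable_map hC h.reachable

theorem exists_blocks_of_moved (hφ : IsReplacement G C F φ) (hvF : v ∈ F) (hvC : v ∉ C)
    (hv : φ v ≠ v) : ∃ a b, Blocks G (F.image φ) v a b := by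
  have hbranch : 1 < (coverNbrs G C F v).card :=
    not_le.1 fun h => hv (hφ.map_of_isLeaf v ⟨hvC, h⟩)
  obtain ⟨a, ha, b, hb, hab⟩ := Finset.one_lt_card.1 hbranch
  have hadj : ∀ x ∈ coverNbrs G C F v, (within G (F.image φ)).Adj (φ v) x := fun x hx =>
    ⟨(mem_coverNbrs.1 (hφ.coverNbrs_map v hvC ▸ hx)).2, Finset.mem_image_of_mem φ hvF,
      hφ.mem_image_of_mem (mem_coverNbrs.1 hx).1.1 (mem_coverNbrs.1 hx).1.2⟩
  exact ⟨a, b, (hadj a ha).2.2, (hadj b hb).2.2, hab, (mem_coverNbrs.1 ha).2,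
    (mem_coverNbrs.1 hb).2, (hadj a ha).symm.reachable.trans (hadj b hb).reachable⟩

theorem isMaxForest_image (hφ : IsReplacement G C F φ) (hC : G.IsVertexCover C)
    (hF : IsMaxForest G F) : IsMaxForest G (F.image φ) := by
  refine ⟨hφ.isForest_image hC hF.1, fun v hv => ?_⟩
  suffices h : ∃ a b, Blocks G (F.image φ) v a b by
    obtain ⟨a, b, h⟩ := h
    exact h.not_isForest_insert hv
  by_cases hvC : v ∈ C
  · obtain ⟨a, b, h, ha, hb⟩ :=
      hφ.exists_blocks v hvC fun hvF => hv (hφ.mem_image_of_mem hvF hvC)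
    exact ⟨φ a, φ b, hφ.blocks_image hC hF.1 h ha hb⟩
  by_cases hvF : v ∈ F
  · exact hφ.exists_blocks_of_moved hvF hvC fun h => hv (Finset.mem_image.2 ⟨v, hvF, h⟩)
  · obtain ⟨a, b, h⟩ := hF.exists_blocks hvF
    refine ⟨φ a, φ b, hφ.blocks_image hC hF.1 h ?_ ?_⟩
    · rw [hφ.map_of_mem a ((hC h.adj_left).resolve_left hvC)]
      exact h.adj_left
    · rw [hφ.map_of_mem b ((hC h.adj_right).resolve_left hvC)]
      exact h.adj_right

theorem image_inter (hφ : IsReplacement G C F φ) : F.image φ ∩ C = F ∩ C := by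
  ext x
  simp only [Finset.mem_inter, Finset.mem_image]
  constructor
  · rintro ⟨⟨y, hy, rfl⟩, hC⟩
    have hyC := hφ.map_mem_iff.1 hC
    exact ⟨(hφ.map_of_mem y hyC).symm ▸ hy, hC⟩
  · rintro ⟨hx, hxC⟩
    exact ⟨⟨x, hx, hφ.map_of_mem x hxC⟩, hxC⟩

end IsReplacement

end Replacement

/-! ### Building a maximal forest from instructions -/

section Building

variable {V : Type*} [DecidableEq V] {G : SimpleGraph V} {C F T : Finset V} {v : V} {l : List V}

open Classical in
/-- Adds `v` to the forest `F` if the result is a forest. -/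
noncomputable def tryAdd (G : SimpleGraph V) (F : Finset V) (v : V) : Finset V :=
  if IsForest G (insert v F) then insert v F else F

open Classical in
/-- Tries to add `v` if it is a leaf. -/
noncomputable def tryLeaf (G : SimpleGraph V) (C F : Finset V) (v : V) : Finset V :=
  if IsLeaf G C F v then tryAdd G F v else F

/-- Completes the forest `F` by a greedy pass through `l` for the leaves and another one for all
vertices. -/
noncomputable def complete (G : SimpleGraph V) (C : Finset V) (l : List V) (F : Finset V) :
    Finset V :=
  l.foldl (tryAdd G) (l.foldl (tryLeaf G C) F)

theorem subset_tryAdd : F ⊆ tryAdd G F v := by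
  unfold tryAdd
  split_ifs
  · exact Finset.subset_insert _ _
  · exact subset_rfl

theorem IsForest.tryAdd (h : IsForest G F) : IsForest G (tryAdd G F v) := by
  unfold MaxMinFVS.tryAdd
  split_ifs with hv
  exacts [hv, h]

theorem IsForest.tryLeaf (h : IsForest G F) : IsForest G (tryLeaf G C F v) := by
  unfold MaxMinFVS.tryLeaf
  split_ifs
  exacts [h.tryAdd, h]

theorem mem_of_isForest_insert_tryAdd (h : IsForest G (insert v F)) : v ∈ tryAdd G F v := by
  rw [tryAdd, if_pos h]
  exact Finset.mem_insert_self v F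

theorem tryAdd_of_subset (hT : IsForest G T) (hF : F ⊆ T) (hv : v ∈ T) :
    tryAdd G F v = insert v F :=
  if_pos (hT.mono (Finset.insert_subset hv hF))

theorem IsMaxForest.tryAdd_eq (h : IsMaxForest G F) : tryAdd G F v = F := by
  by_cases hv : v ∈ F
  · rw [tryAdd_of_subset h.1 subset_rfl hv, Finset.insert_eq_of_mem hv]
  · exact if_neg (h.2 v hv)

theorem IsMaxForest.foldl_tryAdd_eq (h : IsMaxForest G F) : l.foldl (tryAdd G) F = F :=
  List.foldlRecOn (motive := (· = F)) l _ rfl fun E hE v _ => by rw [hE, h.tryAdd_eq]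

theorem subset_foldl_tryAdd : F ⊆ l.foldl (tryAdd G) F :=
  List.foldlRecOn (motive := (F ⊆ ·)) l _ subset_rfl fun _ hE _ _ => hE.trans subset_tryAdd

theorem foldl_tryAdd_of_subset (hT : IsForest G T) (hF : F ⊆ T) (hl : ∀ v ∈ l, v ∈ T) :
    l.foldl (tryAdd G) F = F ∪ l.toFinset := by
  induction l generalizing F with
  | nil => simp
  | cons v l ih =>
    rw [List.foldl_cons, tryAdd_of_subset hT hF (hl v (by simp)),
      ih (Finset.insert_subset (hl v (by simp)) hF) fun x hx => hl x (by simp [hx]),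
      List.toFinset_cons, Finset.union_insert, Finset.insert_union]

theorem not_isForest_insert_foldl_tryAdd (hv : v ∈ l) (hn : v ∉ l.foldl (tryAdd G) F) :
    ¬ IsForest G (insert v (l.foldl (tryAdd G) F)) := by
  obtain ⟨l₁, l₂, rfl⟩ := List.append_of_mem hv
  rw [List.foldl_append, List.foldl_cons] at hn ⊢
  intro h
  have hsub := subset_foldl_tryAdd (G := G) (F := tryAdd G (l₁.foldl (tryAdd G) F) v) (l := l₂)
  exact hn (hsub (mem_of_isForest_insert_tryAdd
    (h.mono (Finset.insert_subset_insert v (subset_tryAdd.trans hsub)))))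

theorem isMaxForest_complete (hF : IsForest G F) (hl : ∀ v, v ∈ l) :
    IsMaxForest G (complete G C l F) := by
  have hleaf : IsForest G (l.foldl (tryLeaf G C) F) :=
    List.foldlRecOn (motive := IsForest G) l _ hF fun _ hE _ _ => hE.tryLeaf
  exact ⟨List.foldlRecOn (motive := IsForest G) l _ hleaf fun _ hE _ _ => hE.tryAdd,
    fun v hv => not_isForest_insert_foldl_tryAdd (hl v) hv⟩

theorem isLeaf_congr {E : Finset V} (h : E ∩ C = F ∩ C) : IsLeaf G C E v ↔ IsLeaf G C F v := by
  rw [IsLeaf, IsLeaf, coverNbrs, coverNbrs, h]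

theorem tryAdd_inter (hv : v ∉ C) : tryAdd G F v ∩ C = F ∩ C := by
  unfold tryAdd
  split_ifs
  · exact Finset.insert_inter_of_notMem hv
  · rfl

open Classical in
theorem foldl_tryLeaf :
    l.foldl (tryLeaf G C) F = (l.filter fun v => IsLeaf G C F v).foldl (tryAdd G) F := by
  suffices h : ∀ E, E ∩ C = F ∩ C →
      l.foldl (tryLeaf G C) E = (l.filter fun v => IsLeaf G C F v).foldl (tryAdd G) E from h F rfl
  induction l with
  | nil => exact fun _ _ => rfl
  | cons v l ih =>
    intro E hE
    by_cases hv : IsLeaf G C F v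
    · rw [List.foldl_cons, List.filter_cons_of_pos (by simpa using hv), List.foldl_cons, tryLeaf,
        if_pos ((isLeaf_congr hE).2 hv), ih _ ((tryAdd_inter hv.1).trans hE)]
    · rw [List.foldl_cons, List.filter_cons_of_neg (by simpa using hv), tryLeaf,
        if_neg (mt (isLeaf_congr hE).1 hv), ih _ hE]

/-- The instructions by which a forest is built: do nothing, add a vertex, mark a vertex, or add a
vertex that fits the marks and clear the marks. -/
inductive Instr (V : Type*)
  | nop
  | flush
  | add (v : V)
  | mark (v : V)

/-- All vertices named by the instruction lie in `C`. -/
def Instr.Over (C : Finset V) : Instr V → Prop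
  | .nop => True
  | .flush => True
  | .add v => v ∈ C
  | .mark v => v ∈ C

/-- The state in which instructions are executed: the current forest and the marked vertices. -/
structure Config (V : Type*) where
  forest : Finset V
  marks : Finset V

/-- The vertex `v` lies outside `C` and is adjacent to all vertices of `C ∩ R` and, among the
vertices of `C ∩ F`, to no others. -/
def Fits (G : SimpleGraph V) (C F R : Finset V) (v : V) : Prop :=
  v ∉ C ∧ ∀ x ∈ C, (x ∈ R → G.Adj v x) ∧ (G.Adj v x → x ∈ F → x ∈ R)

open Classical in
/-- The last vertex of `l` that fits the forest `F` and the marks `R`. -/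
noncomputable def lastFit (G : SimpleGraph V) (C : Finset V) (l : List V) (F R : Finset V) :
    Option V :=
  l.reverse.find? fun v => Fits G C F R v

/-- The effect of an instruction, where the vertices are searched in the order of `l`. -/
noncomputable def Instr.run (G : SimpleGraph V) (C : Finset V) (l : List V) (σ : Config V) :
    Instr V → Config V
  | .nop => σ
  | .flush => ⟨(lastFit G C l σ.forest σ.marks).elim σ.forest (tryAdd G σ.forest), ∅⟩
  | .add v => ⟨tryAdd G σ.forest v, σ.marks⟩
  | .mark v => ⟨σ.forest, insert v σ.marks⟩

/-- The forest that results from a list of instructions. -/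
noncomputable def build (G : SimpleGraph V) (C : Finset V) (l : List V) (is : List (Instr V)) :
    Finset V :=
  complete G C l (is.foldl (Instr.run G C l) ⟨∅, ∅⟩).forest

theorem IsForest.run {σ : Config V} (h : IsForest G σ.forest) (i : Instr V) :
    IsForest G (i.run G C l σ).forest := by
  cases i with
  | nop => exact h
  | flush =>
    simp only [Instr.run]
    cases lastFit G C l σ.forest σ.marks with
    | none => exact h
    | some v => exact h.tryAdd
  | add v => exact h.tryAdd
  | mark v => exact h

theorem isMaxForest_build (hl : ∀ v, v ∈ l) (is : List (Instr V)) :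
    IsMaxForest G (build G C l is) :=
  isMaxForest_complete (List.foldlRecOn (motive := fun σ : Config V => IsForest G σ.forest)
    is (Instr.run G C l) (isForest_empty (G := G)) fun _ hσ i _ => hσ.run i) hl

omit [DecidableEq V] in
theorem fits_of_lastFit_eq_some {R : Finset V} (h : lastFit G C l F R = some v) :
    Fits G C F R v := by
  simpa using List.find?_some h

omit [DecidableEq V] in
theorem exists_lastFit_eq_some {R : Finset V} (hl : ∀ v, v ∈ l) (h : Fits G C F R v) :
    ∃ u, lastFit G C l F R = some u := by
  rw [← Option.isSome_iff_exists, lastFit, List.find?_isSome]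
  exact ⟨v, by simpa using hl v, by simpa using h⟩

theorem lastFit_congr {E R : Finset V} (h : E ∩ C = F ∩ C) :
    lastFit G C l E R = lastFit G C l F R := by
  have hiff : ∀ x ∈ C, (x ∈ E ↔ x ∈ F) := fun x hx => by
    simpa [hx] using Finset.ext_iff.1 h x
  have hfits : Fits G C E R = Fits G C F R := by
    funext v
    simp +contextual only [Fits, hiff]
  rw [lastFit, lastFit, hfits]

theorem foldl_run_map_add {E R : Finset V} {L : List V} :
    (L.map Instr.add).foldl (Instr.run G C l) ⟨E, R⟩ = ⟨L.foldl (tryAdd G) E, R⟩ := by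
  induction L generalizing E with
  | nil => rfl
  | cons v _ ih => exact ih

theorem foldl_run_map_mark {E R : Finset V} {L : List V} :
    (L.map Instr.mark).foldl (Instr.run G C l) ⟨E, R⟩ = ⟨E, R ∪ L.toFinset⟩ := by
  induction L generalizing R with
  | nil => simp
  | cons v L ih =>
    rw [List.map_cons, List.foldl_cons, Instr.run, ih, List.toFinset_cons, Finset.union_insert,
      Finset.insert_union]

end Building

/-! ### Few instructions suffice -/

section Script

variable {V : Type*} [DecidableEq V] {G : SimpleGraph V} {C F : Finset V} {P Q : V → V} {u v : V}
  {l : List V}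

open Classical in
/-- The vertices of `F` outside `C` that are no leaves. -/
noncomputable def branches (G : SimpleGraph V) (C F : Finset V) : Finset V :=
  (F \ C).filter fun v => ¬ IsLeaf G C F v

/-- The vertices of `C` marked in order to replace the branch `v`, if the vertices `P s` and `Q s`
block each vertex `s` outside `F`. -/
noncomputable def branchMarks (G : SimpleGraph V) (C F : Finset V) (P Q : V → V) (v : V) :
    Finset V :=
  coverNbrs G C F v ∪ (C \ F).filter fun s => P s = v ∨ Q s = v

/-- The instructions that rebuild `F`, up to a replacement of the branches. -/
noncomputable def script (G : SimpleGraph V) (C F : Finset V) (P Q : V → V) : List (Instr V) :=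
  (F ∩ C).toList.map .add ++
    (branches G C F).toList.flatMap fun v =>
      (branchMarks G C F P Q v).toList.map .mark ++ [.flush]

/-- Replaces every branch by the last vertex of `l` that fits its marks. -/
noncomputable def replaceBranch (G : SimpleGraph V) (C : Finset V) (l : List V) (F : Finset V)
    (P Q : V → V) (v : V) : V :=
  if v ∈ branches G C F then (lastFit G C l F (branchMarks G C F P Q v)).getD v else v

theorem mem_branches :
    v ∈ branches G C F ↔ v ∈ F ∧ v ∉ C ∧ 2 ≤ (coverNbrs G C F v).card := by
  simp only [branches, IsLeaf, Finset.mem_filter, Finset.mem_sdiff, not_and, not_le]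
  tauto

theorem mem_branchMarks {x : V} : x ∈ branchMarks G C F P Q v ↔
    x ∈ coverNbrs G C F v ∨ (x ∈ C ∧ x ∉ F) ∧ (P x = v ∨ Q x = v) := by
  simp [branchMarks]

theorem branchMarks_subset : branchMarks G C F P Q v ⊆ C := fun _ hx =>
  (mem_branchMarks.1 hx).elim (fun h => (mem_coverNbrs.1 h).1.2) fun h => h.1.1

theorem over_of_mem_script {i : Instr V} (hi : i ∈ script G C F P Q) : i.Over C := by
  simp only [script, List.mem_append, List.mem_map, Finset.mem_toList, List.mem_flatMap,
    List.mem_singleton] at hi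
  rcases hi with ⟨x, hx, rfl⟩ | ⟨v, -, ⟨x, hx, rfl⟩ | rfl⟩
  exacts [(Finset.mem_inter.1 hx).2, branchMarks_subset hx, trivial]

theorem sum_card_filter_eq_le (J D : Finset V) (f : V → V) :
    ∑ v ∈ J, (D.filter fun s => f s = v).card ≤ D.card := by
  rw [Finset.sum_card_fiberwise_eq_card_filter]
  exact Finset.card_filter_le _ _

theorem sum_card_branchMarks_le (J : Finset V) : ∑ v ∈ J, (branchMarks G C F P Q v).card ≤
    ∑ v ∈ J, (coverNbrs G C F v).card + 2 * (C \ F).card := by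
  calc ∑ v ∈ J, (branchMarks G C F P Q v).card
      ≤ ∑ v ∈ J, ((coverNbrs G C F v).card + (((C \ F).filter fun s => P s = v).card +
          ((C \ F).filter fun s => Q s = v).card)) := by
        refine Finset.sum_le_sum fun v _ => (Finset.card_union_le _ _).trans ?_
        rw [Finset.filter_or]
        gcongr
        exact Finset.card_union_le _ _
    _ ≤ _ := by
        have hP := sum_card_filter_eq_le J (C \ F) P
        have hQ := sum_card_filter_eq_le J (C \ F) Q
        rw [Finset.sum_add_distrib, Finset.sum_add_distrib]
        omega

-- The forest has at most `|F ∩ C| + |J|` edges between `F ∩ C` and the set `J` of the branches, but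
-- at least `2|J|`, whence `|J| ≤ |F ∩ C|`.
theorem length_script_le (hF : IsForest G F) : (script G C F P Q).length ≤ 4 * C.card := by
  have hlen : (script G C F P Q).length = (F ∩ C).card +
      (∑ v ∈ branches G C F, (branchMarks G C F P Q v).card + (branches G C F).card) := by
    simp [script, List.length_flatMap, Finset.sum_map_toList, Finset.sum_add_distrib]
  have hmarks := sum_card_branchMarks_le (G := G) (C := C) (F := F) (P := P) (Q := Q)
    (branches G C F)
  have hupper : ∑ v ∈ branches G C F, (coverNbrs G C F v).card ≤
      (F ∩ C).card + (branches G C F).card := by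
    refine IsForest.sum_card_adj_le ?_ (hF.mono ?_)
    · rw [Finset.disjoint_left]
      exact fun x hx hxJ => (mem_branches.1 hxJ).2.1 (Finset.mem_inter.1 hx).2
    · exact Finset.union_subset Finset.inter_subset_left fun x hx => (mem_branches.1 hx).1
  have hlower : (branches G C F).card * 2 ≤ ∑ v ∈ branches G C F, (coverNbrs G C F v).card := by
    rw [← smul_eq_mul]
    exact Finset.card_nsmul_le_sum _ _ _ fun v hv => (mem_branches.1 hv).2.2
  have hsplit : (F ∩ C).card + (C \ F).card = C.card := by
    rw [Finset.inter_comm]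
    exact Finset.card_inter_add_card_sdiff C F
  omega

theorem fits_branchMarks (hPQ : ∀ s ∉ F, Blocks G F s (P s) (Q s)) (hv : v ∈ branches G C F) :
    Fits G C F (branchMarks G C F P Q v) v := by
  refine ⟨(mem_branches.1 hv).2.1, fun x hx => ⟨fun hxR => ?_, fun hvx hxF => ?_⟩⟩
  · rcases mem_branchMarks.1 hxR with h | ⟨⟨-, hxF⟩, rfl | rfl⟩
    exacts [(mem_coverNbrs.1 h).2, (hPQ x hxF).adj_left.symm, (hPQ x hxF).adj_right.symm]
  · exact mem_branchMarks.2 (.inl (mem_coverNbrs.2 ⟨⟨hxF, hx⟩, hvx⟩))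

theorem lastFit_branchMarks (hPQ : ∀ s ∉ F, Blocks G F s (P s) (Q s)) (hl : ∀ v, v ∈ l)
    (hv : v ∈ branches G C F) :
    lastFit G C l F (branchMarks G C F P Q v) = some (replaceBranch G C l F P Q v) := by
  obtain ⟨u, hu⟩ := exists_lastFit_eq_some hl (fits_branchMarks hPQ hv)
  rw [replaceBranch, if_pos hv, hu, Option.getD_some]

theorem fits_replaceBranch (hPQ : ∀ s ∉ F, Blocks G F s (P s) (Q s)) (hl : ∀ v, v ∈ l)
    (hv : v ∈ branches G C F) :
    Fits G C F (branchMarks G C F P Q v) (replaceBranch G C l F P Q v) :=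
  fits_of_lastFit_eq_some (lastFit_branchMarks hPQ hl hv)

theorem replaceBranch_of_notMem (hv : v ∉ branches G C F) : replaceBranch G C l F P Q v = v :=
  if_neg hv

theorem coverNbrs_of_fits (hv : Fits G C F (branchMarks G C F P Q v) u) :
    coverNbrs G C F u = coverNbrs G C F v := by
  ext x
  rw [mem_coverNbrs, mem_coverNbrs]
  refine and_congr_right fun hx => ⟨fun hux => ?_, fun hvx => ?_⟩
  · have hmem := (hv.2 x hx.2).2 hux hx.1
    exact (mem_branchMarks.1 hmem).elim (fun h => (mem_coverNbrs.1 h).2) fun h => absurd hx.1 h.1.2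
  · exact (hv.2 x hx.2).1 (mem_branchMarks.2 (.inl (mem_coverNbrs.2 ⟨hx, hvx⟩)))

theorem isReplacement_replaceBranch (hPQ : ∀ s ∉ F, Blocks G F s (P s) (Q s))
    (hl : ∀ v, v ∈ l) : IsReplacement G C F (replaceBranch G C l F P Q) where
  map_of_mem v hv := replaceBranch_of_notMem fun h => (mem_branches.1 h).2.1 hv
  map_notMem v hv := by
    by_cases h : v ∈ branches G C F
    · exact (fits_replaceBranch hPQ hl h).1
    · rwa [replaceBranch_of_notMem h]
  coverNbrs_map v _ := by
    by_cases h : v ∈ branches G C F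
    · exact coverNbrs_of_fits (fits_replaceBranch hPQ hl h)
    · rw [replaceBranch_of_notMem h]
  map_of_isLeaf v hv := replaceBranch_of_notMem fun h => by
    have := (mem_branches.1 h).2.2
    have := hv.2
    omega
  exists_blocks s hs hsF := by
    have hadj : ∀ v, G.Adj s v → (P s = v ∨ Q s = v) → G.Adj s (replaceBranch G C l F P Q v) := by
      intro v hsv hv
      by_cases h : v ∈ branches G C F
      · exact (((fits_replaceBranch hPQ hl h).2 s hs).1
          (mem_branchMarks.2 (.inr ⟨⟨hs, hsF⟩, hv⟩))).symm
      · rwa [replaceBranch_of_notMem h]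
    have hblocks := hPQ s hsF
    exact ⟨P s, Q s, hblocks, hadj _ hblocks.adj_left (.inl rfl),
      hadj _ hblocks.adj_right (.inr rfl)⟩

theorem foldl_run_block (hPQ : ∀ s ∉ F, Blocks G F s (P s) (Q s)) (hl : ∀ v, v ∈ l)
    {E : Finset V} (hE : E ∩ C = F ∩ C) (hv : v ∈ branches G C F) :
    ((branchMarks G C F P Q v).toList.map Instr.mark ++ [Instr.flush]).foldl
        (Instr.run G C l) ⟨E, ∅⟩ =
      ⟨tryAdd G E (replaceBranch G C l F P Q v), ∅⟩ := by
  rw [List.foldl_append, foldl_run_map_mark, List.foldl_cons, List.foldl_nil, Instr.run,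
    Finset.empty_union, Finset.toList_toFinset, lastFit_congr hE, lastFit_branchMarks hPQ hl hv,
    Option.elim_some]

theorem foldl_run_blocks (hPQ : ∀ s ∉ F, Blocks G F s (P s) (Q s)) (hl : ∀ v, v ∈ l)
    {E : Finset V} (hE : E ∩ C = F ∩ C) {L : List V} (hL : ∀ v ∈ L, v ∈ branches G C F) :
    (L.flatMap fun v => (branchMarks G C F P Q v).toList.map Instr.mark ++ [Instr.flush]).foldl
        (Instr.run G C l) ⟨E, ∅⟩ =
      ⟨(L.map (replaceBranch G C l F P Q)).foldl (tryAdd G) E, ∅⟩ := by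
  induction L generalizing E with
  | nil => rfl
  | cons v L ih =>
    have hv := hL v (by simp)
    rw [List.flatMap_cons, List.foldl_append, foldl_run_block hPQ hl hE hv, List.map_cons,
      List.foldl_cons, ih ((tryAdd_inter (fits_replaceBranch hPQ hl hv).1).trans hE)
      fun x hx => hL x (by simp [hx])]

theorem forest_foldl_run_script (hC : G.IsVertexCover C) (hF : IsForest G F)
    (hPQ : ∀ s ∉ F, Blocks G F s (P s) (Q s)) (hl : ∀ v, v ∈ l) :
    ((script G C F P Q).foldl (Instr.run G C l) ⟨∅, ∅⟩).forest =
      F ∩ C ∪ (branches G C F).image (replaceBranch G C l F P Q) := by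
  have hφ := isReplacement_replaceBranch (C := C) hPQ hl
  have hcover : (F ∩ C).toList.foldl (tryAdd G) ∅ = F ∩ C := by
    rw [foldl_tryAdd_of_subset hF (Finset.empty_subset F)
      fun v hv => (Finset.mem_inter.1 (Finset.mem_toList.1 hv)).1, Finset.empty_union,
      Finset.toList_toFinset]
  rw [script, List.foldl_append, foldl_run_map_add, hcover, foldl_run_blocks hPQ hl
    (by rw [Finset.inter_assoc, Finset.inter_self]) fun v hv => Finset.mem_toList.1 hv,
    foldl_tryAdd_of_subset (hφ.isForest_image hC hF) (hφ.image_inter ▸ Finset.inter_subset_left)]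
  · ext x
    simp
  · simp only [List.mem_map, Finset.mem_toList, Finset.mem_image]
    rintro _ ⟨v, hv, rfl⟩
    exact ⟨v, (mem_branches.1 hv).1, rfl⟩

theorem complete_eq {E : Finset V} (hC : G.IsVertexCover C) (hF : IsMaxForest G F)
    (hEF : E ⊆ F) (hE : E ∩ C = F ∩ C) (hleaf : ∀ v ∈ F, v ∈ E ∨ IsLeaf G C F v)
    (hl : ∀ v, v ∈ l) : complete G C l E = F := by
  classical
  rw [complete, foldl_tryLeaf, foldl_tryAdd_of_subset hF.1 hEF]
  · suffices h : E ∪ (l.filter fun v => IsLeaf G C E v).toFinset = F by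
      rw [h, hF.foldl_tryAdd_eq]
    ext v
    simp only [isLeaf_congr hE, Finset.mem_union, List.mem_toFinset, List.mem_filter, hl,
      decide_eq_true_eq, true_and]
    exact ⟨fun h => h.elim (fun h => hEF h) fun h => hF.mem_of_isLeaf hC h, hleaf v⟩
  · simp only [isLeaf_congr hE, List.mem_filter, decide_eq_true_eq, and_imp]
    exact fun v _ hv => hF.mem_of_isLeaf hC hv

theorem build_script (hC : G.IsVertexCover C) (hF : IsMaxForest G F)
    (hPQ : ∀ s ∉ F, Blocks G F s (P s) (Q s)) (hl : ∀ v, v ∈ l) :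
    build G C l (script G C F P Q) = F.image (replaceBranch G C l F P Q) := by
  have hφ := isReplacement_replaceBranch (C := C) hPQ hl
  have hinter := hφ.image_inter
  have hbranches := Finset.image_subset_image (f := replaceBranch G C l F P Q)
    fun v (hv : v ∈ branches G C F) => (mem_branches.1 hv).1
  have hstart : F ∩ C ⊆ F.image (replaceBranch G C l F P Q) :=
    hinter ▸ Finset.inter_subset_left
  rw [build, forest_foldl_run_script hC hF.1 hPQ hl]
  refine complete_eq hC (hφ.isMaxForest_image hC hF) (Finset.union_subset hstart hbranches)
    (subset_antisymm (Finset.inter_subset_inter_right (Finset.union_subset hstart hbranches)) ?_)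
    (fun y hy => ?_) hl
  · rw [hinter]
    exact fun x hx => Finset.mem_inter.2 ⟨Finset.mem_union_left _ hx, (Finset.mem_inter.1 hx).2⟩
  · obtain ⟨x, hx, rfl⟩ := Finset.mem_image.1 hy
    by_cases hxC : x ∈ C
    · rw [hφ.map_of_mem x hxC]
      exact .inl (Finset.mem_union_left _ (Finset.mem_inter.2 ⟨hx, hxC⟩))
    by_cases hbranch : x ∈ branches G C F
    · exact .inl (Finset.mem_union_right _ (Finset.mem_image_of_mem _ hbranch))
    · have hleaf : IsLeaf G C F x :=
        ⟨hxC, by simpa [mem_branches, hx, hxC, Nat.lt_succ_iff] using hbranch⟩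
      rw [hφ.map_of_isLeaf x hleaf]
      exact .inr ((isLeaf_congr hinter).2 hleaf)

theorem IsMaxForest.exists_card_build_eq (hC : G.IsVertexCover C) (hF : IsMaxForest G F)
    (hl : ∀ v, v ∈ l) : ∃ is : List (Instr V), (∀ i ∈ is, i.Over C) ∧
      is.length ≤ 4 * C.card ∧ (build G C l is).card = F.card := by
  choose! P Q hPQ using fun s (hs : s ∉ F) => hF.exists_blocks hs
  have hφ := isReplacement_replaceBranch (C := C) hPQ hl
  refine ⟨script G C F P Q, fun i => over_of_mem_script, length_script_le hF.1, ?_⟩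
  rw [build_script hC hF hPQ hl]
  exact Finset.card_image_of_injOn (hφ.injOn hF.1)

theorem build_append_replicate_nop (is : List (Instr V)) (m : ℕ) :
    build G C l (is ++ List.replicate m .nop) = build G C l is := by
  have hnop : ∀ σ, (List.replicate m Instr.nop).foldl (Instr.run G C l) σ = σ := fun σ =>
    List.foldlRecOn (motive := (· = σ)) _ _ rfl fun τ hτ i hi => by
      rw [List.eq_of_mem_replicate hi, hτ, Instr.run]
  rw [build, build, List.foldl_append, hnop]

theorem maxMinFVS_iff_exists_build [Fintype V] (hC : G.IsVertexCover C) (hl : ∀ v, v ∈ l)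
    (k : ℕ) : MaxMinFVS G k ↔ ∃ is : List (Instr V), (∀ i ∈ is, i.Over C) ∧
      is.length = 4 * C.card ∧ k + (build G C l is).card ≤ Fintype.card V := by
  rw [maxMinFVS_iff_exists_isMaxForest]
  constructor
  · rintro ⟨F, hF, hk⟩
    obtain ⟨is, hover, hlen, hcard⟩ := hF.exists_card_build_eq hC hl
    refine ⟨is ++ List.replicate (4 * C.card - is.length) .nop, fun i hi => ?_, ?_, ?_⟩
    · rcases List.mem_append.1 hi with hi | hi
      · exact hover i hi
      · rw [List.eq_of_mem_replicate hi]
        trivial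
    · rw [List.length_append, List.length_replicate]
      omega
    · rwa [build_append_replicate_nop, hcard]
  · rintro ⟨is, -, -, hk⟩
    exact ⟨_, isMaxForest_build hl is, hk⟩

end Script

/-! ### Component labels -/

section ComponentLabels

variable {n : ℕ} {G : SimpleGraph (Fin n)} {F : Finset (Fin n)} {lab : Fin n → ℕ} {u v w : Fin n}

/-- The neighbours of `v` in `F`. -/
def nbrsIn (G : SimpleGraph (Fin n)) (F : Finset (Fin n)) (v : Fin n) : Set (Fin n) :=
  {a | a ∈ F ∧ G.Adj v a}

/-- `lab` labels the trees of the forest `F`: every tree has a vertex `w` such that `w + 1` is the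
label of all its vertices, and the vertices outside `F` have label 0. -/
structure Labels (G : SimpleGraph (Fin n)) (F : Finset (Fin n)) (lab : Fin n → ℕ) : Prop where
  isForest : IsForest G F
  mem_iff : ∀ v, lab v ≠ 0 ↔ v ∈ F
  eq_iff : ∀ u ∈ F, ∀ v ∈ F, (lab u = lab v ↔ (within G F).Reachable u v)
  exists_root : ∀ u ∈ F, ∃ w ∈ F, lab u = w + 1

open Classical in
/-- The labels after the vertex `v` and the trees of its neighbours are joined. -/
noncomputable def relabel (G : SimpleGraph (Fin n)) (F : Finset (Fin n)) (lab : Fin n → ℕ)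
    (v u : Fin n) : ℕ :=
  if u = v ∨ lab u ∈ lab '' nbrsIn G F v then v + 1 else lab u

theorem labels_empty (h : ∀ v, lab v = 0) : Labels G ∅ lab where
  isForest := isForest_empty
  mem_iff v := by simp [h]
  eq_iff := by simp
  exists_root := by simp

theorem relabel_self : relabel G F lab v v = v + 1 := if_pos (.inl rfl)

theorem relabel_of_mem (h : lab u ∈ lab '' nbrsIn G F v) : relabel G F lab v u = v + 1 :=
  if_pos (.inr h)

theorem relabel_of_notMem (hu : u ≠ v) (h : lab u ∉ lab '' nbrsIn G F v) :
    relabel G F lab v u = lab u :=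
  if_neg (not_or_intro hu h)

namespace Labels

theorem le (h : Labels G F lab) (v : Fin n) : lab v ≤ n := by
  by_cases hv : v ∈ F
  · obtain ⟨w, -, hw⟩ := h.exists_root v hv
    omega
  · rw [not_not.1 (mt (h.mem_iff v).1 hv)]
    exact Nat.zero_le n

theorem isForest_insert_iff (h : Labels G F lab) (hv : v ∉ F) :
    IsForest G (insert v F) ↔ Set.InjOn lab (nbrsIn G F v) := by
  refine ⟨fun hF a ha b hb hab => by_contra fun hne => ?_, fun hd => h.isForest.insert
    fun a b hB => hB.ne ?_⟩
  · exact Blocks.not_isForest_insert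
      ⟨ha.1, hb.1, hne, ha.2, hb.2, (h.eq_iff a ha.1 b hb.1).1 hab⟩ hv hF
  · exact hd ⟨hB.left_mem, hB.adj_left⟩ ⟨hB.right_mem, hB.adj_right⟩
      ((h.eq_iff a hB.left_mem b hB.right_mem).2 hB.reachable)

theorem ne_succ (h : Labels G F lab) (hv : v ∉ F) (hu : u ∈ F) : lab u ≠ v + 1 := by
  intro heq
  obtain ⟨w, hw, hw'⟩ := h.exists_root u hu
  exact hv (Fin.ext (by omega : (w : ℕ) = v) ▸ hw)

theorem relabel_eq_of_adj (h : Labels G F lab) (hadj : (within G (insert v F)).Adj u w) :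
    relabel G F lab v u = relabel G F lab v w := by
  wlog hwv : w ≠ v generalizing u w
  · obtain rfl := not_not.1 hwv
    exact (this hadj.symm hadj.1.ne).symm
  obtain ⟨huw, hu, hw⟩ := hadj
  replace hw := (Finset.mem_insert.1 hw).resolve_left hwv
  by_cases huv : u = v
  · subst huv
    have hmem : lab w ∈ lab '' nbrsIn G F u := ⟨w, ⟨hw, huw⟩, rfl⟩
    rw [relabel_self, relabel_of_mem hmem]
  · have hu := (Finset.mem_insert.1 hu).resolve_left huv
    have hlab : lab u = lab w :=
      (h.eq_iff u hu w hw).2 (Adj.reachable (G := within G F) ⟨huw, hu, hw⟩)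
    by_cases hmem : lab w ∈ lab '' nbrsIn G F v
    · rw [relabel_of_mem (hlab ▸ hmem), relabel_of_mem hmem]
    · rw [relabel_of_notMem huv (hlab ▸ hmem), relabel_of_notMem hwv hmem, hlab]

theorem relabel_eq_of_reachable (h : Labels G F lab)
    (hr : (within G (insert v F)).Reachable u w) :
    relabel G F lab v u = relabel G F lab v w := by
  obtain ⟨p⟩ := hr
  induction p with
  | nil => rfl
  | cons hadj _ ih => rw [h.relabel_eq_of_adj hadj, ih]

theorem reachable_of_relabel_eq_succ (h : Labels G F lab) (hv : v ∉ F) (hu : u ∈ insert v F)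
    (hlab : relabel G F lab v u = v + 1) : (within G (insert v F)).Reachable u v := by
  by_cases huv : u = v
  · rw [huv]
  have hu := (Finset.mem_insert.1 hu).resolve_left huv
  by_cases hmem : lab u ∈ lab '' nbrsIn G F v
  · obtain ⟨a, ⟨ha, hva⟩, hau⟩ := hmem
    have hav : (within G (insert v F)).Adj a v := ⟨hva.symm, by simp [ha], by simp⟩
    exact (((h.eq_iff u hu a ha).1 hau.symm).mono (within_mono (Finset.subset_insert v F))).trans
      hav.reachable
  · rw [relabel_of_notMem huv hmem] at hlab
    exact absurd hlab (h.ne_succ hv hu)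

theorem reachable_of_relabel_eq (h : Labels G F lab) (hv : v ∉ F) (hu : u ∈ insert v F)
    (hw : w ∈ insert v F) (hlab : relabel G F lab v u = relabel G F lab v w) :
    (within G (insert v F)).Reachable u w := by
  by_cases hu' : relabel G F lab v u = v + 1
  · exact (h.reachable_of_relabel_eq_succ hv hu hu').trans
      (h.reachable_of_relabel_eq_succ hv hw (hlab ▸ hu')).symm
  have old : ∀ x ∈ insert v F, relabel G F lab v x ≠ v + 1 → x ∈ F ∧ relabel G F lab v x = lab x :=
    fun x hx hne =>
      have hxv : x ≠ v := fun h => hne (h ▸ relabel_self)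
      ⟨(Finset.mem_insert.1 hx).resolve_left hxv,
        relabel_of_notMem hxv fun hmem => hne (relabel_of_mem hmem)⟩
  obtain ⟨huF, hulab⟩ := old u hu hu'
  obtain ⟨hwF, hwlab⟩ := old w hw (hlab ▸ hu')
  exact ((h.eq_iff u huF w hwF).1 (by rw [← hulab, ← hwlab, hlab])).mono
    (within_mono (Finset.subset_insert v F))

theorem relabel_ne_zero_iff (h : Labels G F lab) :
    relabel G F lab v u ≠ 0 ↔ u ∈ insert v F := by
  rw [Finset.mem_insert, ← h.mem_iff]
  by_cases hmem : lab u ∈ lab '' nbrsIn G F v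
  · obtain ⟨a, ha, hau⟩ := id hmem
    simpa [relabel_of_mem hmem, ← hau] using Or.inr ((h.mem_iff a).2 ha.1)
  · by_cases huv : u = v
    · simp [huv, relabel_self]
    · simp [relabel_of_notMem huv hmem, huv]

theorem exists_root_relabel (h : Labels G F lab) (hu : u ∈ insert v F) :
    ∃ w ∈ insert v F, relabel G F lab v u = w + 1 := by
  by_cases hv : u = v ∨ lab u ∈ lab '' nbrsIn G F v
  · exact ⟨v, by simp, if_pos hv⟩
  · obtain ⟨huv, hmem⟩ := not_or.1 hv
    obtain ⟨w, hw, hroot⟩ := h.exists_root u ((Finset.mem_insert.1 hu).resolve_left huv)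
    exact ⟨w, by simp [hw], by rw [relabel_of_notMem huv hmem, hroot]⟩

theorem insert (h : Labels G F lab) (hv : v ∉ F) (hF : IsForest G (insert v F)) :
    Labels G (insert v F) (relabel G F lab v) where
  isForest := hF
  mem_iff _ := h.relabel_ne_zero_iff
  eq_iff _ hu _ hw := ⟨h.reachable_of_relabel_eq hv hu hw, h.relabel_eq_of_reachable⟩
  exists_root _ := h.exists_root_relabel

end Labels

end ComponentLabels

/-! ### Adding a vertex to the forest -/

section AddingVertex

/-- The variables of the program. -/
inductive Var
  | size | goal | i | j | coverSize | len | base | bound | acc | code | step | pass | rest | quot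
  | digit | vertex | other | flag | cand | choice | count | answer
  deriving DecidableEq

/-- The arrays of the program: the addresses of the rows of the adjacency matrix, the vertex cover
as a set and as a list, and the current forest by its labels, the marks, and the labels seen. -/
inductive Arr
  | row | cover | list | label | mark | seen
  deriving DecidableEq

/-- The statements of the program. -/
abbrev Code := Stmt Var Arr

/-- The environments in which the program is executed. -/
abbrev Store := Env Var Arr

/-- The first two registers are those that hold the input. -/
def layout : Layout Var Arr where
  base := 22
  reg := Var.ctorIdx
  slot := Arr.ctorIdx
  reg_injective x y := by cases x <;> cases y <;> simp [Var.ctorIdx]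
  reg_lt x := by cases x <;> decide
  slot_injective x y := by cases x <;> cases y <;> simp [Arr.ctorIdx]
  slot_lt a := by cases a <;> decide

/-- The entry of the adjacency matrix for the vertices `x` and `y`. -/
def edge (x y : Var) : Expr Var Arr := .inp (.add (.get .row (.var x)) (.var y))

/-- Sets the first `size` cells of an array to 0. -/
def clear (a : Arr) : Code := .loop .other .size (.put a (.var .other) (.lit 0))

/-- Records the label of `other`, or clears `flag` if it was already recorded. -/
def recordLabel : Code :=
  .ite (.get .seen (.get .label (.var .other))) (.set .flag (.lit 0))
    (.put .seen (.get .label (.var .other)) (.lit 1))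

/-- Records the label of `other` if it is a neighbour of `vertex` in the forest. -/
def collect : Code :=
  .ite (edge .vertex .other) (.ite (.get .label (.var .other)) recordLabel .skip) .skip

/-- Records the labels of all neighbours of `vertex` in the forest; `flag` becomes 0 if two of them
agree. -/
def collectAll : Code :=
  clear .seen ;;
  .put .seen (.var .size) (.lit 0) ;;
  .set .flag (.lit 1) ;;
  .loop .other .size collect

/-- Moves `other` to the tree of `vertex` if its label was recorded. -/
def join : Code :=
  .ite (.get .seen (.get .label (.var .other)))
    (.put .label (.var .other) (.add (.var .vertex) (.lit 1))) .skip

/-- Moves the recorded trees and `vertex` itself to the tree with label `vertex + 1`. -/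
def merge : Code :=
  .loop .other .size join ;; .put .label (.var .vertex) (.add (.var .vertex) (.lit 1))

/-- Adds `vertex` to the forest if the result is a forest. -/
def tryAddCode : Code :=
  .ite (.get .label (.var .vertex)) .skip
    (collectAll ;;
    .ite (.var .flag) merge .skip)

variable {n : ℕ} {G : SimpleGraph (Fin n)} {F : Finset (Fin n)} {M : ℕ → ℕ} {s s' : Store}
  {p : Code} {v u : Fin n}

/-- The input is the adjacency matrix of `G`, and the addresses of its rows are known. -/
structure HasMatrix (G : SimpleGraph (Fin n)) (M : ℕ → ℕ) (s : Store) : Prop where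
  size : s.var .size = n
  row : ∀ i < n, s.arr .row i = i * n
  adj : ∀ i j : Fin n, M (i * n + j) ≠ 0 ↔ G.Adj i j

theorem HasMatrix.of_frame (h : HasMatrix G M s) (fr : p.Frame s s')
    (hx : p.writes .size = false) (ha : p.writesArr .row = false) : HasMatrix G M s' where
  size := (fr.var _ hx).trans h.size
  row i hi := by rw [fr.arr _ ha, h.row i hi]
  adj := h.adj

theorem HasMatrix.edge_ne_zero_iff (h : HasMatrix G M s) {x y : Var} (hx : s.var x = v)
    (hy : s.var y = u) : (edge x y).eval M s ≠ 0 ↔ G.Adj v u := by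
  simp only [edge, Expr.eval, hx, hy, h.row v v.2]
  exact h.adj v u

theorem eval_clear {a : Arr} (hn : s.var .size = n) (v : Fin n) :
    ((clear a).eval M s).arr a v = 0 := by
  refine Stmt.loop_rule_finset hn (fun S s' => ∀ v ∈ S, s'.arr a (v : Fin n) = 0) (by simp)
    (fun S v _ s' _ ih u hu => ?_) v (Finset.mem_univ v)
  rw [Finset.mem_insert] at hu
  simp only [Stmt.eval, Expr.eval, Env.put_arr, Env.set_var, Env.set_arr, true_and, if_true,
    Fin.val_inj]
  split_ifs with huv
  · rfl
  · exact ih u (hu.resolve_left huv)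

/-- The labels of the vertices in `N` have been recorded, and `flag` tells whether they are
distinct. -/
structure Collected (N : Set (Fin n)) (lab : Fin n → ℕ) (s : Store) : Prop where
  flag : s.var .flag ≠ 0 ↔ Set.InjOn lab N
  seen : ∀ l ≤ n, s.arr .seen l ≠ 0 ↔ l ∈ lab '' N

theorem Collected.recordLabel {N : Set (Fin n)} {lab : Fin n → ℕ} (hN : Collected N lab s)
    (hle : lab u ≤ n) (huN : u ∉ N) (hs : s.arr .label (s.var .other) = lab u) :
    Collected (insert u N) lab (recordLabel.eval M s) := by
  have hseen := hN.seen _ hle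
  simp only [MaxMinFVS.recordLabel, Stmt.eval, Expr.eval, hs]
  constructor
  · rw [Set.injOn_insert huN, ← hN.flag, ← hseen]
    split_ifs with h <;> simp [Env.set_var, h]
  · intro l hl
    rw [Set.image_insert_eq, Set.mem_insert_iff, ← hN.seen l hl]
    split_ifs with h
    · rw [Env.set_arr, or_iff_right_of_imp (by rintro rfl; exact h)]
    · simp only [Env.put_arr, true_and]
      split_ifs with hlu <;> simp [hlu]

theorem Collected.collect {S : Set (Fin n)} {lab : Fin n → ℕ} (h : HasMatrix G M s)
    (hv : s.var .vertex = v) (hu : s.var .other = u) (hlab : Labels G F lab)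
    (hs : s.arr .label u = lab u) (huS : u ∉ S) (hS : Collected (S ∩ nbrsIn G F v) lab s) :
    Collected (insert u S ∩ nbrsIn G F v) lab (collect.eval M s) := by
  have hadj := h.edge_ne_zero_iff hv hu
  have hmem : Expr.eval M s (.get .label (.var .other)) ≠ 0 ↔ u ∈ F := by
    simp only [Expr.eval, hu, hs, hlab.mem_iff]
  unfold MaxMinFVS.collect
  by_cases hA : G.Adj v u
  · rw [Stmt.eval_ite_pos (hadj.2 hA)]
    by_cases hF : u ∈ F
    · have huN : u ∈ nbrsIn G F v := ⟨hF, hA⟩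
      rw [Stmt.eval_ite_pos (hmem.2 hF), Set.insert_inter_of_mem huN]
      exact hS.recordLabel (hlab.le u) (fun h => huS h.1) (hu ▸ hs)
    · rw [Stmt.eval_ite_neg (not_not.1 (mt hmem.1 hF)), Set.insert_inter_of_notMem fun h => hF h.1]
      exact hS
  · rw [Stmt.eval_ite_neg (not_not.1 (mt hadj.1 hA)), Set.insert_inter_of_notMem fun h => hA h.2]
    exact hS

/-- The labels of the vertices. -/
def labels (n : ℕ) (s : Store) (v : Fin n) : ℕ := s.arr .label v

theorem labels_of_frame (fr : p.Frame s s') (hp : p.writesArr .label = false) :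
    labels n s' = labels n s :=
  funext fun v => congrFun (fr.arr _ hp) v

theorem eval_collect (h : HasMatrix G M s) (hv : s.var .vertex = v)
    (hlab : Labels G F (labels n s)) (hseen : ∀ l ≤ n, s.arr .seen l = 0)
    (hflag : s.var .flag = 1) :
    Collected (nbrsIn G F v) (labels n s) ((Stmt.loop .other .size collect).eval M s) := by
  have := Stmt.loop_rule_finset (p := collect) (M := M) (i := .other) h.size
    (fun S s' => Collected (S ∩ nbrsIn G F v) (labels n s) s')
    ⟨by simp [hflag], by simpa using hseen⟩ fun S u hu s' fr hS => by
      have fr' := fr.set_index u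
      rw [Finset.coe_insert]
      exact Collected.collect (h.of_frame fr' rfl rfl) ((fr'.var .vertex rfl).trans hv)
        (by simp [Env.set_var]) hlab (congrFun (fr'.arr .label rfl) u) hu
        ⟨by simpa [Env.set_var] using hS.flag, hS.seen⟩
  simpa using this

theorem eval_collectAll (h : HasMatrix G M s) (hv : s.var .vertex = v)
    (hlab : Labels G F (labels n s)) :
    Collected (nbrsIn G F v) (labels n s) (collectAll.eval M s) := by
  have hclear := eval_clear (M := M) (a := .seen) h.size
  have fr := (clear .seen).frame_eval M s
  simp only [collectAll, Stmt.eval_seq]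
  generalize (clear .seen).eval M s = s₁ at hclear fr ⊢
  have hn := fr.var .size rfl |>.trans h.size
  have hlab₁ : labels n s = labels n (s₁.put .seen n 0 |>.set .flag 1) := by
    funext u
    simp [labels, Env.put_arr_of_ne, fr.arr .label rfl]
  rw [hlab₁] at hlab ⊢
  simp only [Stmt.eval, Expr.eval, hn] at hlab ⊢
  refine eval_collect ⟨by simp [Env.set_var, hn], fun i hi => ?_, h.adj⟩ ?_ hlab (fun l hl => ?_) ?_
  · simp [Env.put_arr_of_ne, fr.arr .row rfl, h.row i hi]
  · simp [Env.set_var, fr.var .vertex rfl, hv]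
  · simp only [Env.set_arr, Env.put_arr, true_and]
    split_ifs with hln
    · rfl
    · exact hclear ⟨l, by omega⟩
  · simp [Env.set_var]

theorem eval_join (hn : s.var .size = n) (v : Fin n) :
    labels n ((Stmt.loop .other .size join).eval M s) v =
      if s.arr .seen (labels n s v) ≠ 0 then s.var .vertex + 1 else labels n s v := by
  have := Stmt.loop_rule_finset (p := join) (M := M) (i := .other) hn
    (fun S s' => ∀ v, labels n s' v = if v ∈ S ∧ s.arr .seen (labels n s v) ≠ 0
      then s.var .vertex + 1 else labels n s v) (by simp) fun S u hu s' fr hS v => by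
      have hu' := hS u
      simp only [hu, false_and, if_false] at hu'
      simp only [labels] at hu' hS ⊢
      simp only [join, Stmt.eval, Expr.eval, Env.set_var, Env.set_arr, if_true, reduceCtorEq,
        if_false, fr.arr .seen rfl, fr.var .vertex rfl, hu']
      by_cases hvu : v = u
      · subst hvu
        split_ifs <;> simp_all [Env.put_arr]
      · have hvu' : (v : ℕ) ≠ u := fun h => hvu (Fin.ext h)
        refine Eq.trans ?_ ((hS v).trans (if_congr (by simp [hvu]) rfl rfl))
        split_ifs <;> simp [Env.put_arr, hvu']
  simpa using this v

theorem labels_eval_merge (hlab : Labels G F (labels n s)) (hv : s.var .vertex = v)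
    (hn : s.var .size = n) (hs : Collected (nbrsIn G F v) (labels n s) s) :
    labels n (merge.eval M s) = relabel G F (labels n s) v := by
  funext u
  have hv' : ((Stmt.loop .other .size join).eval M s).var .vertex = v :=
    (Stmt.eval_var rfl).trans hv
  have hj := eval_join (M := M) hn u
  rw [merge, Stmt.eval_seq]
  generalize (Stmt.loop .other .size join).eval M s = s₁ at hv' hj ⊢
  have hput : labels n (s₁.put .label v (v + 1)) u =
      if u = v then (v : ℕ) + 1 else labels n s₁ u := by
    simp [labels, Env.put_arr, Fin.val_inj]
  simp only [Stmt.eval, Expr.eval, hv', hput]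
  split_ifs with huv
  · rw [huv, relabel_self]
  by_cases hmem : labels n s u ∈ labels n s '' nbrsIn G F v
  · rw [relabel_of_mem hmem, hj, if_pos ((hs.seen _ (hlab.le u)).2 hmem), hv]
  · rw [relabel_of_notMem huv hmem, hj, if_neg (mt (hs.seen _ (hlab.le u)).1 hmem)]

theorem eval_tryAddCode (h : HasMatrix G M s) (hv : s.var .vertex = v)
    (hlab : Labels G F (labels n s)) :
    Labels G (tryAdd G F v) (labels n (tryAddCode.eval M s)) := by
  have hmem : Expr.eval M s (.get .label (.var .vertex)) ≠ 0 ↔ v ∈ F := by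
    simp only [Expr.eval, hv]
    exact hlab.mem_iff v
  rw [tryAddCode]
  by_cases hvF : v ∈ F
  · rwa [Stmt.eval_ite_pos (hmem.2 hvF), tryAdd_of_subset hlab.isForest subset_rfl hvF,
      Finset.insert_eq_of_mem hvF]
  rw [Stmt.eval_ite_neg (not_not.1 (mt hmem.1 hvF)), Stmt.eval_seq]
  have hs := eval_collectAll h hv hlab
  have fr := collectAll.frame_eval M s
  generalize collectAll.eval M s = s₁ at hs fr ⊢
  have hlab₁ : labels n s₁ = labels n s := labels_of_frame fr rfl
  have hflag : Expr.eval M s₁ (.var .flag) ≠ 0 ↔ IsForest G (insert v F) :=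
    hs.flag.trans (hlab.isForest_insert_iff hvF).symm
  by_cases hF : IsForest G (insert v F)
  · rw [← hlab₁] at hlab hs
    rw [Stmt.eval_ite_pos (hflag.2 hF), tryAdd_of_subset hF (Finset.subset_insert _ _)
      (Finset.mem_insert_self _ _), labels_eval_merge hlab ((fr.var .vertex rfl).trans hv)
      (h.of_frame fr rfl rfl).size hs]
    exact hlab.insert hvF hF
  · rwa [Stmt.eval_ite_neg (not_not.1 (mt hflag.1 hF)), tryAdd, if_neg hF, Stmt.eval, hlab₁]

end AddingVertex

/-! ### Executing an instruction -/

section Instructions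

/-- Clears `flag` if `other` is in the cover and keeps `cand` from fitting the marks. -/
def testOther : Code :=
  .ite (.get .cover (.var .other))
    (.ite (.get .mark (.var .other))
      (.ite (edge .cand .other) .skip (.set .flag (.lit 0)))
      (.ite (edge .cand .other)
        (.ite (.get .label (.var .other)) (.set .flag (.lit 0)) .skip) .skip))
    .skip

/-- Stores `cand + 1` in `choice` if `cand` fits the marks. -/
def testCand : Code :=
  .ite (.get .cover (.var .cand)) .skip
    (.set .flag (.lit 1) ;;
    .loop .other .size testOther ;;
    .ite (.var .flag) (.set .choice (.add (.var .cand) (.lit 1))) .skip)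

/-- Finds the last vertex that fits the marks; `choice` becomes 0 if there is none. -/
def findFit : Code := .set .choice (.lit 0) ;; .loop .cand .size testCand

/-- Performs the instruction `flush`. -/
def flushCode : Code :=
  findFit ;;
  clear .mark ;;
  .ite (.var .choice) (.set .vertex (.sub (.var .choice) (.lit 1)) ;; tryAddCode) .skip

/-- Performs the instruction number `digit`. -/
def instrCode : Code :=
  .ite (.var .digit)
    (.ite (.sub (.var .digit) (.lit 1))
      (.ite (.sub (.add (.var .coverSize) (.lit 2)) (.var .digit))
        (.set .vertex (.get .list (.sub (.var .digit) (.lit 2))) ;; tryAddCode)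
        (.put .mark (.get .list (.sub (.sub (.var .digit) (.lit 2)) (.var .coverSize))) (.lit 1)))
      flushCode)
    .skip

/-- The instructions over the vertex cover `L`, in the order in which they are numbered. -/
def instrs {V : Type*} (L : List V) : List (Instr V) :=
  .nop :: .flush :: (L.map .add ++ L.map .mark)

variable {n : ℕ} {G : SimpleGraph (Fin n)} {L : List (Fin n)} {M : ℕ → ℕ} {s s' : Store}
  {p : Code} {σ : Config (Fin n)} {v x : Fin n}

/-- The vertex cover computed by the program is `L`. -/
structure HasCover (G : SimpleGraph (Fin n)) (L : List (Fin n)) (M : ℕ → ℕ) (s : Store) : Prop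
    extends HasMatrix G M s where
  coverSize : s.var .coverSize = L.length
  cover : ∀ v : Fin n, s.arr .cover v ≠ 0 ↔ v ∈ L
  list : ∀ k, (hk : k < L.length) → s.arr .list k = L[k]

/-- The statement `p` writes neither the number of vertices nor the vertex cover. -/
def keepsCover (p : Code) : Bool :=
  !(p.writes .size || p.writes .coverSize || p.writesArr .row || p.writesArr .cover ||
    p.writesArr .list)

theorem HasCover.of_frame (h : HasCover G L M s) (fr : p.Frame s s') (hp : keepsCover p = true) :
    HasCover G L M s' := by
  simp only [keepsCover, Bool.not_eq_true', Bool.or_eq_false_iff, and_assoc] at hp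
  obtain ⟨hsize, hcoverSize, hrow, hcover, hlist⟩ := hp
  exact ⟨h.toHasMatrix.of_frame fr hsize hrow, (fr.var _ hcoverSize).trans h.coverSize,
    fun v => by rw [fr.arr _ hcover, h.cover], fun k hk => by rw [fr.arr _ hlist, h.list k hk]⟩

/-- The forest and the marks of `σ` are represented by the arrays `label` and `mark`. -/
structure Holds (G : SimpleGraph (Fin n)) (σ : Config (Fin n)) (s : Store) : Prop where
  labels : Labels G σ.forest (labels n s)
  mark : ∀ v : Fin n, s.arr .mark v ≠ 0 ↔ v ∈ σ.marks

theorem Holds.of_frame (hσ : Holds G σ s) (fr : p.Frame s s')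
    (hl : p.writesArr .label = false) (hm : p.writesArr .mark = false) : Holds G σ s' := by
  refine ⟨?_, fun v => by rw [fr.arr _ hm, hσ.mark]⟩
  rw [labels_of_frame fr hl]
  exact hσ.labels

theorem eval_testOther (h : HasCover G L M s) (hσ : Holds G σ s) (hv : s.var .cand = v)
    (hx : s.var .other = x) :
    (testOther.eval M s).var .flag ≠ 0 ↔ (x ∈ L →
      (x ∈ σ.marks → G.Adj v x) ∧ (G.Adj v x → x ∈ σ.forest → x ∈ σ.marks)) ∧
      s.var .flag ≠ 0 := by
  have hadj := h.edge_ne_zero_iff hv hx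
  have hcover := h.cover x
  have hmark := hσ.mark x
  have hforest : s.arr .label x ≠ 0 ↔ x ∈ σ.forest := hσ.labels.mem_iff x
  rw [← hcover, ← hmark, ← hforest, ← hadj]
  simp only [testOther, Stmt.eval, Expr.eval, hx]
  split_ifs <;> simp_all [Env.set_var]

theorem eval_loop_testOther (h : HasCover G L M s) (hσ : Holds G σ s) (hv : s.var .cand = v)
    (hflag : s.var .flag = 1) (hvL : v ∉ L) :
    ((Stmt.loop .other .size testOther).eval M s).var .flag ≠ 0 ↔
      Fits G L.toFinset σ.forest σ.marks v := by
  have := Stmt.loop_rule_finset (p := testOther) (M := M) (i := .other) h.size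
    (fun S s' => s'.var .flag ≠ 0 ↔ ∀ x ∈ S, x ∈ L →
      (x ∈ σ.marks → G.Adj v x) ∧ (G.Adj v x → x ∈ σ.forest → x ∈ σ.marks)) (by simp [hflag])
    fun S x _ s' fr hS => by
      have fr' := fr.set_index x
      rw [eval_testOther (h.of_frame fr' rfl) (hσ.of_frame fr' rfl rfl)
        ((fr'.var .cand rfl).trans hv) (x := x) (by simp [Env.set_var]), Finset.forall_mem_insert]
      exact and_congr_right' hS
  simpa [Fits, hvL] using this

open Classical in
theorem eval_testCand (h : HasCover G L M s) (hσ : Holds G σ s) (hv : s.var .cand = v) :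
    (testCand.eval M s).var .choice =
      if Fits G L.toFinset σ.forest σ.marks v then (v : ℕ) + 1 else s.var .choice := by
  have hcover : Expr.eval M s (.get .cover (.var .cand)) ≠ 0 ↔ v ∈ L := by
    simp only [Expr.eval, hv, h.cover]
  rw [testCand]
  by_cases hvL : v ∈ L
  · rw [Stmt.eval_ite_pos (hcover.2 hvL), if_neg fun hf => hf.1 (List.mem_toFinset.2 hvL)]
    rfl
  have fr := (Stmt.set .flag (.lit 1) : Code).frame_eval M s
  have hfits := eval_loop_testOther (h.of_frame fr rfl) (hσ.of_frame fr rfl rfl)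
    ((fr.var .cand rfl).trans hv) (by simp [Stmt.eval, Expr.eval, Env.set_var]) hvL
  rw [Stmt.eval_ite_neg (not_not.1 (mt hcover.1 hvL)), Stmt.eval_seq, Stmt.eval_seq]
  have fr' := (Stmt.loop .other .size testOther : Code).frame_eval M
    ((Stmt.set .flag (.lit 1)).eval M s)
  generalize (Stmt.loop .other .size testOther).eval M _ = s₁ at hfits fr' ⊢
  rw [Stmt.eval, ← if_congr hfits rfl rfl, ← hv, ← fr.var .cand rfl, ← fr'.var .cand rfl,
    ← fr.var .choice rfl, ← fr'.var .choice rfl, apply_ite (fun s : Store => s.var .choice)]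
  rfl

theorem foldl_ite_eq_find?_reverse {α : Type*} (P : α → Prop) [DecidablePred P] (l : List α) :
    l.foldl (fun o a => if P a then some a else o) none = l.reverse.find? fun a => P a := by
  induction l using List.reverseRecOn with
  | nil => rfl
  | append_singleton l a ih => by_cases h : P a <;> simp [ih, h]

open Classical in
theorem eval_findFit (h : HasCover G L M s) (hσ : Holds G σ s) :
    (findFit.eval M s).var .choice =
      (lastFit G L.toFinset (List.finRange n) σ.forest σ.marks).elim 0 fun v => (v : ℕ) + 1 := by
  have fr := (Stmt.set .choice (.lit 0) : Code).frame_eval M s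
  rw [findFit, Stmt.eval_seq, lastFit, ← foldl_ite_eq_find?_reverse]
  refine Stmt.loop_rule_foldl (p := testCand) (M := M) (i := .cand)
    ((fr.var .size rfl).trans h.size) _
    (fun (o : Option (Fin n)) s' => s'.var .choice = o.elim 0 fun v => (v : ℕ) + 1)
    (by simp [Stmt.eval, Expr.eval, Env.set_var]) fun o v s' fr' ho => ?_
  replace fr' := fr'.set_index v
  rw [eval_testCand (v := v) ((h.of_frame fr rfl).of_frame fr' rfl)
    ((hσ.of_frame fr rfl rfl).of_frame fr' rfl rfl) (by simp [Env.set_var])]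
  split_ifs
  · rfl
  · exact ho

theorem Holds.tryAdd (hσ : Holds G σ s) (h : HasMatrix G M s) (hv : s.var .vertex = v) :
    Holds G ⟨tryAdd G σ.forest v, σ.marks⟩ (tryAddCode.eval M s) :=
  ⟨eval_tryAddCode h hv hσ.labels, fun u => by rw [Stmt.eval_arr rfl, hσ.mark]⟩

theorem Holds.clear_mark (hσ : Holds G σ s) (hn : s.var .size = n) :
    Holds G ⟨σ.forest, ∅⟩ ((clear .mark).eval M s) := by
  refine ⟨?_, fun v => by simp [eval_clear hn v]⟩
  rw [labels_of_frame ((clear .mark).frame_eval M s) rfl]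
  exact hσ.labels

theorem eval_flushCode (h : HasCover G L M s) (hσ : Holds G σ s) :
    Holds G (Instr.run G L.toFinset (List.finRange n) σ .flush) (flushCode.eval M s) := by
  have fr := findFit.frame_eval M s
  have hc := eval_findFit h hσ
  rw [flushCode, Stmt.eval_seq, Stmt.eval_seq]
  generalize findFit.eval M s = s₁ at fr hc ⊢
  have h₁ := h.of_frame fr rfl
  have fr' := (clear .mark).frame_eval M s₁
  have hσ' := (hσ.of_frame fr rfl rfl).clear_mark (M := M) h₁.size
  rw [← fr'.var .choice rfl] at hc
  replace h := h₁.of_frame fr' rfl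
  generalize (clear .mark).eval M s₁ = s₂ at hc h hσ' ⊢
  rw [Instr.run]
  cases hfit : lastFit G L.toFinset (List.finRange n) σ.forest σ.marks with
  | none =>
    rw [Stmt.eval_ite_neg (by simp [Expr.eval, hc, hfit])]
    exact hσ'
  | some v =>
    rw [Stmt.eval_ite_pos (by simp [Expr.eval, hc, hfit]), Stmt.eval_seq]
    have fr₂ := (Stmt.set .vertex (.sub (.var .choice) (.lit 1)) : Code).frame_eval M s₂
    refine (hσ'.of_frame fr₂ rfl rfl).tryAdd (h.of_frame fr₂ rfl).toHasMatrix ?_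
    simp [Stmt.eval, Expr.eval, Env.set_var, hc, hfit]

theorem Holds.mark_insert (hσ : Holds G σ s) (v : Fin n) :
    Holds G ⟨σ.forest, insert v σ.marks⟩ (s.put .mark v 1) := by
  refine ⟨hσ.labels, fun u => ?_⟩
  rw [Env.put_arr, Finset.mem_insert, ← hσ.mark, Fin.ext_iff]
  split_ifs with hu <;> simp_all

theorem eval_instrCode (h : HasCover G L M s) (hσ : Holds G σ s)
    (hd : s.var .digit < (instrs L).length) :
    Holds G (Instr.run G L.toFinset (List.finRange n) σ (instrs L)[s.var .digit])
      (instrCode.eval M s) := by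
  rw [instrCode]
  generalize hd' : s.var .digit = d at hd ⊢
  match d with
  | 0 =>
    rw [Stmt.eval_ite_neg (by simp [Expr.eval, hd'])]
    exact hσ
  | 1 =>
    rw [Stmt.eval_ite_pos (by simp [Expr.eval, hd']), Stmt.eval_ite_neg (by simp [Expr.eval, hd'])]
    exact eval_flushCode h hσ
  | k + 2 =>
    rw [Stmt.eval_ite_pos (by simp [Expr.eval, hd']), Stmt.eval_ite_pos (by simp [Expr.eval, hd'])]
    by_cases hk : k < L.length
    · rw [Stmt.eval_ite_pos (by simp only [Expr.eval, hd', h.coverSize]; omega), Stmt.eval_seq]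
      have fr := (Stmt.set .vertex (.get .list (.sub (.var .digit) (.lit 2))) : Code).frame_eval M s
      have hget : (instrs L)[k + 2] = .add L[k] := by simp [instrs, hk]
      rw [hget]
      refine (hσ.of_frame fr rfl rfl).tryAdd (h.of_frame fr rfl).toHasMatrix ?_
      simp [Stmt.eval, Expr.eval, Env.set_var, hd', h.list k hk]
    · have hk' : k - L.length < L.length := by simp [instrs] at hd; omega
      rw [Stmt.eval_ite_neg (by simp only [Expr.eval, hd', h.coverSize]; omega)]
      have hget : (instrs L)[k + 2] = .mark L[k - L.length] := by
        simp [instrs, List.getElem_append, hk]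
      rw [hget]
      simpa [Stmt.eval, Expr.eval, hd', h.coverSize, h.list _ hk', Instr.run] using
        hσ.mark_insert L[k - L.length]

end Instructions

/-! ### Executing a list of instructions -/

section InstructionLists

/-- One step of the division of `rest` by `base`. -/
def subtractBase : Code :=
  .ite (.sub (.var .rest) (.sub (.var .base) (.lit 1)))
    (.set .rest (.sub (.var .rest) (.var .base)) ;; .set .quot (.add (.var .quot) (.lit 1))) .skip

/-- Division of `rest` by `base`: leaves the quotient in `quot` and the remainder in `rest`. -/
def divide : Code := .set .quot (.lit 0) ;; .loop .pass .bound subtractBase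

/-- Moves the last digit of `rest` to `digit`. -/
def nextDigit : Code := divide ;; .set .digit (.var .rest) ;; .set .rest (.var .quot)

/-- Performs the instruction whose number is the last digit of `rest`, and removes this digit. -/
def digitCode : Code := nextDigit ;; instrCode

theorem length_instrs {V : Type*} (L : List V) : (instrs L).length = 2 * L.length + 2 := by
  simp [instrs]
  omega

/-- The first `m` instructions of the list with number `w`, whose digits in base
`(instrs L).length` are the numbers of the instructions, the last digit being the first one. -/
def program {V : Type*} (L : List V) (w m : ℕ) : List (Instr V) :=
  (List.range m).map fun j => (instrs L)[w / (instrs L).length ^ j % (instrs L).length]'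
    (Nat.mod_lt _ (by simp [instrs]))

variable {n : ℕ} {G : SimpleGraph (Fin n)} {L : List (Fin n)} {M : ℕ → ℕ} {s s' : Store}
  {p : Code} {σ : Config (Fin n)} {w : ℕ}

/-- Besides the graph and the cover `L`, the store holds the numbers that bound the search. -/
structure Ready (G : SimpleGraph (Fin n)) (L : List (Fin n)) (M : ℕ → ℕ) (s : Store) : Prop
    extends HasCover G L M s where
  len : s.var .len = 4 * L.length
  base : s.var .base = (instrs L).length
  bound : s.var .bound = (instrs L).length ^ (4 * L.length)

/-- The statement `p` writes none of the data prepared for the search. -/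
def keepsReady (p : Code) : Bool :=
  keepsCover p && !(p.writes .len || p.writes .base || p.writes .bound)

theorem Ready.of_frame (h : Ready G L M s) (fr : p.Frame s s') (hp : keepsReady p = true) :
    Ready G L M s' := by
  simp only [keepsReady, Bool.and_eq_true, Bool.not_eq_true', Bool.or_eq_false_iff, and_assoc] at hp
  obtain ⟨hcover, hlen, hbase, hbound⟩ := hp
  exact ⟨h.toHasCover.of_frame fr hcover, (fr.var _ hlen).trans h.len,
    (fr.var _ hbase).trans h.base, (fr.var _ hbound).trans h.bound⟩

theorem eval_divide (hb : 2 ≤ s.var .base) (hr : s.var .rest < s.var .bound) :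
    s.var .rest / s.var .base = (divide.eval M s).var .quot ∧
      s.var .rest % s.var .base = (divide.eval M s).var .rest := by
  have inv := Stmt.loop_rule (i := .pass) (x := .bound) (p := subtractBase) (M := M)
    (s := s.set .quot 0)
    (fun m s' => s'.var .rest + s.var .base * s'.var .quot = s.var .rest ∧
      (s'.var .rest < s.var .base ∨ s'.var .quot = m)) (by simp [Env.set_var])
    fun m _ s' fr ⟨_, _⟩ => by
      have hbase := fr.var .base rfl
      simp only [Env.set_var, reduceCtorEq, if_false] at hbase
      simp only [subtractBase, Stmt.eval, Expr.eval, Env.set_var, reduceCtorEq, if_false, hbase]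
      split_ifs with hge
      · simp only [Env.set_var, reduceCtorEq, if_false, if_true, Nat.mul_add]
        omega
      · simp only [Env.set_var, reduceCtorEq, if_false]
        omega
  have heval : divide.eval M s = (Stmt.loop .pass .bound subtractBase).eval M (s.set .quot 0) := rfl
  rw [← heval] at inv
  obtain ⟨hsum, hlt⟩ := inv
  refine (Nat.div_mod_unique (by omega)).2 ⟨hsum, hlt.resolve_right fun hquot => ?_⟩
  simp only [Env.set_var, reduceCtorEq, if_false] at hquot
  have := Nat.mul_le_mul hb (hquot ▸ le_refl (s.var .bound))
  omega

theorem eval_nextDigit (hb : 2 ≤ s.var .base) (hr : s.var .rest < s.var .bound) :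
    (nextDigit.eval M s).var .rest = s.var .rest / s.var .base ∧
      (nextDigit.eval M s).var .digit = s.var .rest % s.var .base := by
  obtain ⟨hquot, hrest⟩ := eval_divide (M := M) hb hr
  rw [hquot, hrest]
  simp [nextDigit, Stmt.eval, Expr.eval, Env.set_var]

theorem eval_digitCode (h : Ready G L M s) (hσ : Holds G σ s) (hr : s.var .rest < s.var .bound) :
    (digitCode.eval M s).var .rest = s.var .rest / (instrs L).length ∧
      Holds G (Instr.run G L.toFinset (List.finRange n) σ
        ((instrs L)[s.var .rest % (instrs L).length]'(Nat.mod_lt _ (by simp [instrs]))))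
        (digitCode.eval M s) := by
  obtain ⟨hrest, hdigit⟩ := eval_nextDigit (M := M) (by rw [h.base, length_instrs]; omega) hr
  rw [h.base] at hrest hdigit
  have fr := nextDigit.frame_eval M s
  rw [digitCode, Stmt.eval_seq]
  refine ⟨(Stmt.eval_var rfl).trans hrest, ?_⟩
  simp only [← hdigit]
  exact eval_instrCode (h.of_frame fr rfl).toHasCover (hσ.of_frame fr rfl rfl) _

theorem eval_digits (h : Ready G L M s) (hσ : Holds G σ s) (hw : s.var .rest = w)
    (hlt : w < s.var .bound) :
    Holds G ((program L w (4 * L.length)).foldl (Instr.run G L.toFinset (List.finRange n)) σ)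
      ((Stmt.loop .step .len digitCode).eval M s) := by
  rw [← h.len]
  refine (Stmt.loop_rule (p := digitCode) (fun m s' => s'.var .rest = w / (instrs L).length ^ m ∧
    Holds G ((program L w m).foldl (Instr.run G L.toFinset (List.finRange n)) σ) s')
    ⟨by simpa using hw, hσ⟩ fun m _ s' fr ⟨hrest, ih⟩ => ?_).2
  have frm := (Stmt.set .step (.lit m) : Code).frame_eval M s'
  have hrest' : (s'.set .step m).var .rest = w / (instrs L).length ^ m := by
    simpa [Env.set_var] using hrest
  have hd := eval_digitCode (h.of_frame (fr.set_index m) rfl) (ih.of_frame frm rfl rfl)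
    (((hrest'.trans_le (Nat.div_le_self _ _)).trans_lt hlt).trans_eq
      ((fr.set_index m).var .bound rfl).symm)
  simp only [hrest'] at hd
  refine ⟨by rw [hd.1, Nat.div_div_eq_div_mul, pow_succ], ?_⟩
  rw [program, List.range_succ, List.map_append, List.foldl_append]
  exact hd.2

end InstructionLists

/-! ### Completing the forest -/

section Search

/-- Adds 1 to `count`. -/
def increment : Code := .set .count (.add (.var .count) (.lit 1))

/-- Counts `other` if it is a neighbour of `cand` in the cover and in the forest. -/
def countNbr : Code :=
  .ite (.get .cover (.var .other))
    (.ite (.get .label (.var .other)) (.ite (edge .cand .other) increment .skip) .skip) .skip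

/-- Counts the neighbours of `cand` in the cover and in the forest. -/
def countNbrs : Code := .set .count (.lit 0) ;; .loop .other .size countNbr

/-- Adds `cand` to the forest if it is a leaf and the result is a forest. -/
def tryLeafCode : Code :=
  .ite (.get .cover (.var .cand)) .skip
    (countNbrs ;;
    .ite (.sub (.lit 2) (.var .count)) (.set .vertex (.var .cand) ;; tryAddCode) .skip)

/-- Completes the forest greedily. -/
def completeCode : Code := .loop .cand .size tryLeafCode ;; .loop .vertex .size tryAddCode

/-- Makes the forest and the set of marks empty and initializes the list of digits. -/
def startCode : Code := .set .rest (.var .code) ;; clear .label ;; clear .mark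

/-- Builds the forest for the instruction list number `code`. -/
def buildCode : Code := startCode ;; .loop .step .len digitCode ;; completeCode

/-- Counts the vertices of the forest. -/
def countForest : Code :=
  .set .count (.lit 0) ;; .loop .other .size (.ite (.get .label (.var .other)) increment .skip)

/-- Sets `answer` to 1 if the instruction list number `code` yields a small enough forest. -/
def guessCode : Code :=
  buildCode ;;
  countForest ;;
  .ite (.sub (.add (.var .goal) (.var .count)) (.var .size)) .skip (.set .answer (.lit 1))

/-- Tests all instruction lists. -/
def searchCode : Code := .set .answer (.lit 0) ;; .loop .code .bound guessCode

variable {n : ℕ} {G : SimpleGraph (Fin n)} {L : List (Fin n)} {M : ℕ → ℕ} {s : Store}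
  {p : Code} {F : Finset (Fin n)} {v : Fin n}

theorem eval_loop_count (P : Fin n → Prop) [DecidablePred P] (hn : s.var .size = n)
    (hs : s.var .count = 0) (step : ∀ (u : Fin n) s', (Stmt.loop .other .size p).Frame s s' →
      (p.eval M (s'.set .other u)).var .count = s'.var .count + if P u then 1 else 0) :
    ((Stmt.loop .other .size p).eval M s).var .count = (Finset.univ.filter P).card :=
  Stmt.loop_rule_finset hn (fun S s' => s'.var .count = (S.filter P).card) (by simpa using hs)
    fun S u hu s' fr ih => by
      rw [step u s' fr, ih, Finset.filter_insert]
      split_ifs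
      · rw [Finset.card_insert_of_notMem fun h => hu (Finset.mem_filter.1 h).1]
      · rfl

open Classical in
theorem eval_countNbrs (h : HasCover G L M s) (hF : Labels G F (labels n s))
    (hv : s.var .cand = v) :
    (countNbrs.eval M s).var .count = (coverNbrs G L.toFinset F v).card := by
  have fr₀ := (Stmt.set .count (.lit 0) : Code).frame_eval M s
  rw [countNbrs, Stmt.eval_seq, eval_loop_count (fun u => (u ∈ F ∧ u ∈ L) ∧ G.Adj v u)
    ((fr₀.var .size rfl).trans h.size) (by simp [Stmt.eval, Expr.eval, Env.set_var])
    fun u s' fr => ?_]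
  · congr 1
    ext u
    simp [mem_coverNbrs]
  replace fr := fr.set_index u
  have hadj := ((h.of_frame fr₀ rfl).of_frame fr rfl).edge_ne_zero_iff
    ((fr.var .cand rfl).trans ((fr₀.var .cand rfl).trans hv)) (u := u) (y := .other)
    (by simp [Env.set_var])
  have hcover := ((h.of_frame fr₀ rfl).of_frame fr rfl).cover u
  have hlabel := hF.mem_iff u
  rw [← labels_of_frame fr₀ rfl, ← labels_of_frame fr rfl, labels] at hlabel
  rw [Env.set_arr] at hcover hlabel
  simp only [countNbr, increment, Stmt.eval, Expr.eval, Env.set_var, Env.set_arr, if_true]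
  simp only [← hlabel, ← hcover, ← hadj]
  split_ifs <;> simp_all [Env.set_var]

theorem eval_tryLeafCode (h : HasCover G L M s) (hF : Labels G F (labels n s))
    (hv : s.var .cand = v) :
    Labels G (tryLeaf G L.toFinset F v) (labels n (tryLeafCode.eval M s)) := by
  have hcover : Expr.eval M s (.get .cover (.var .cand)) ≠ 0 ↔ v ∈ L := by
    simp only [Expr.eval, hv, h.cover]
  rw [tryLeaf, tryLeafCode]
  by_cases hvL : v ∈ L
  · rwa [Stmt.eval_ite_pos (hcover.2 hvL), if_neg fun hleaf => hleaf.1 (List.mem_toFinset.2 hvL)]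
  rw [Stmt.eval_ite_neg (not_not.1 (mt hcover.1 hvL)), Stmt.eval_seq]
  have hcount := eval_countNbrs h hF hv
  have fr := countNbrs.frame_eval M s
  generalize countNbrs.eval M s = s₁ at hcount fr ⊢
  rw [← labels_of_frame fr rfl] at hF
  by_cases hle : s₁.var .count ≤ 1
  · rw [Stmt.eval_ite_pos (by simp only [Expr.eval]; omega), Stmt.eval_seq,
      if_pos ⟨by simpa using hvL, hcount ▸ hle⟩]
    have fr' := (Stmt.set .vertex (.var .cand) : Code).frame_eval M s₁
    refine eval_tryAddCode ((h.of_frame fr rfl).of_frame fr' rfl).toHasMatrix ?_ hF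
    simp [Stmt.eval, Expr.eval, Env.set_var, fr.var .cand rfl, hv]
  · rwa [Stmt.eval_ite_neg (by simp only [Expr.eval]; omega),
      if_neg fun hleaf => hle (hcount ▸ hleaf.2)]

theorem eval_completeCode (h : HasCover G L M s) (hF : Labels G F (labels n s)) :
    Labels G (complete G L.toFinset (List.finRange n) F) (labels n (completeCode.eval M s)) := by
  rw [completeCode, Stmt.eval_seq, complete]
  have fr := (Stmt.loop .cand .size tryLeafCode).frame_eval M s
  refine Stmt.loop_rule_foldl (p := tryAddCode) ((fr.var .size rfl).trans h.size) _
    (fun F s' => Labels G F (labels n s')) ?_ fun F v s' fr' hF => ?_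
  · refine Stmt.loop_rule_foldl (p := tryLeafCode) h.size _
      (fun F s' => Labels G F (labels n s')) hF fun F v s' fr' hF => ?_
    exact eval_tryLeafCode (h.of_frame (fr'.set_index v) rfl) hF (by simp [Env.set_var])
  · exact eval_tryAddCode ((h.of_frame fr rfl).of_frame (fr'.set_index v) rfl).toHasMatrix
      (by simp [Env.set_var]) hF

/-! ### The search -/

theorem eval_startCode (hn : s.var .size = n) :
    (startCode.eval M s).var .rest = s.var .code ∧ Holds G ⟨∅, ∅⟩ (startCode.eval M s) := by
  have fr := (Stmt.set .rest (.var .code) : Code).frame_eval M s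
  have hrest : ((Stmt.set .rest (.var .code)).eval M s).var .rest = s.var .code := by
    simp [Stmt.eval, Expr.eval, Env.set_var]
  simp only [startCode, Stmt.eval_seq]
  generalize (Stmt.set .rest (.var .code)).eval M s = s₁ at fr hrest ⊢
  replace hn := (fr.var .size rfl).trans hn
  have hn' : ((clear .label).eval M s₁).var .size = n := (Stmt.eval_var rfl).trans hn
  refine ⟨(Stmt.eval_var rfl).trans ((Stmt.eval_var rfl).trans hrest),
    labels_empty fun v => ?_, fun v => by simp [eval_clear hn' v]⟩
  rw [labels_of_frame ((clear .mark).frame_eval M _) rfl]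
  exact eval_clear hn v

theorem eval_buildCode (h : Ready G L M s) (hw : s.var .code < s.var .bound) :
    Labels G (build G L.toFinset (List.finRange n) (program L (s.var .code) (4 * L.length)))
      (labels n (buildCode.eval M s)) := by
  obtain ⟨hrest, hσ⟩ := eval_startCode (G := G) (M := M) h.size
  have fr := startCode.frame_eval M s
  rw [buildCode, Stmt.eval_seq, Stmt.eval_seq]
  generalize startCode.eval M s = s₁ at fr hrest hσ ⊢
  have h₁ := h.of_frame fr rfl
  have fr' := (Stmt.loop .step .len digitCode).frame_eval M s₁
  exact eval_completeCode (h₁.of_frame fr' rfl).toHasCover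
    (eval_digits h₁ hσ hrest (hw.trans_eq (fr.var .bound rfl).symm)).labels

theorem eval_countForest (hn : s.var .size = n) (hF : Labels G F (labels n s)) :
    (countForest.eval M s).var .count = F.card := by
  have fr₀ := (Stmt.set .count (.lit 0) : Code).frame_eval M s
  rw [countForest, Stmt.eval_seq, eval_loop_count (· ∈ F)
    ((fr₀.var .size rfl).trans hn) (by simp [Stmt.eval, Expr.eval, Env.set_var])
    fun u s' fr => ?_]
  · simp
  have hlabel := hF.mem_iff u
  rw [← labels_of_frame fr₀ rfl, ← labels_of_frame fr rfl, labels] at hlabel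
  simp only [increment, Stmt.eval, Expr.eval, Env.set_var, Env.set_arr, if_true, ← hlabel]
  split_ifs <;> simp_all [Env.set_var]

theorem eval_guessCode (h : Ready G L M s) (hw : s.var .code < s.var .bound) :
    (guessCode.eval M s).var .answer =
      if s.var .goal + (build G L.toFinset (List.finRange n)
        (program L (s.var .code) (4 * L.length))).card ≤ n then 1 else s.var .answer := by
  have hF := eval_buildCode h hw
  have fr := buildCode.frame_eval M s
  rw [guessCode, Stmt.eval_seq, Stmt.eval_seq]
  generalize buildCode.eval M s = s₁ at hF fr ⊢
  have h₁ := h.of_frame fr rfl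
  have hcount := eval_countForest (M := M) h₁.size hF
  have fr' := countForest.frame_eval M s₁
  have h₂ := h₁.of_frame fr' rfl
  have hgoal := (fr'.var .goal rfl).trans (fr.var .goal rfl)
  rw [← hcount, ← hgoal]
  generalize countForest.eval M s₁ = s₂ at fr' h₂ ⊢
  split_ifs with hle
  · rw [Stmt.eval_ite_neg (by simp only [Expr.eval, h₂.size]; omega)]
    simp [Stmt.eval, Expr.eval, Env.set_var]
  · rw [Stmt.eval_ite_pos (by simp only [Expr.eval, h₂.size]; omega)]
    exact (fr'.var .answer rfl).trans (fr.var .answer rfl)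

open Classical in
theorem eval_searchCode (h : Ready G L M s) :
    (searchCode.eval M s).var .answer =
      if ∃ w < (instrs L).length ^ (4 * L.length), s.var .goal +
        (build G L.toFinset (List.finRange n) (program L w (4 * L.length))).card ≤ n
      then 1 else 0 := by
  have fr₀ := (Stmt.set .answer (.lit 0) : Code).frame_eval M s
  rw [searchCode, Stmt.eval_seq, ← h.bound, ← fr₀.var .bound rfl]
  refine Stmt.loop_rule (p := guessCode) (fun m s' => s'.var .answer = if ∃ w < m,
    s.var .goal + (build G L.toFinset (List.finRange n)
      (program L w (4 * L.length))).card ≤ n then 1 else 0)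
    (by simp [Stmt.eval, Expr.eval, Env.set_var]) fun m hm s' fr ih => ?_
  replace fr := fr.set_index m
  have hcode : (s'.set .code m).var .code = m := by simp [Env.set_var]
  have hanswer : (s'.set .code m).var .answer = s'.var .answer := by simp [Env.set_var]
  rw [eval_guessCode ((h.of_frame fr₀ rfl).of_frame fr rfl)
    (hcode.trans_lt (hm.trans_eq (fr.var .bound rfl).symm)), hcode, hanswer, fr.var .goal rfl,
    fr₀.var .goal rfl, ih, ← ite_or]
  exact if_congr (or_comm.trans Nat.exists_lt_succ_right.symm) rfl rfl

end Search

section Program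

variable {V : Type*} {L : List V} {is : List (Instr V)}

theorem mem_instrs [DecidableEq V] {i : Instr V} : i ∈ instrs L ↔ i.Over L.toFinset := by
  cases i <;> simp [instrs, Instr.Over]

theorem exists_program_eq (his : ∀ i ∈ is, i ∈ instrs L) :
    ∃ w < (instrs L).length ^ is.length, program L w is.length = is := by
  choose d hd using fun j : Fin is.length => List.mem_iff_get.1 (his _ (is.get_mem j))
  refine ⟨finFunctionFinEquiv d, (finFunctionFinEquiv d).2, List.ext_getElem (by simp [program])
    fun j _ hj => ?_⟩
  have hdigit : (finFunctionFinEquiv d : ℕ) / (instrs L).length ^ j % (instrs L).length =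
      d ⟨j, hj⟩ := congrArg Fin.val (congrFun (finFunctionFinEquiv.symm_apply_apply d) ⟨j, hj⟩)
  simp only [program, List.getElem_map, List.getElem_range, hdigit]
  exact hd ⟨j, hj⟩

theorem exists_program_iff {m : ℕ} {P : List (Instr V) → Prop} :
    (∃ w < (instrs L).length ^ m, P (program L w m)) ↔
      ∃ is : List (Instr V), (∀ i ∈ is, i ∈ instrs L) ∧ is.length = m ∧ P is := by
  constructor
  · rintro ⟨w, -, hw⟩
    exact ⟨_, by simp +contextual [program], by simp [program], hw⟩
  · rintro ⟨is, his, rfl, hP⟩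
    obtain ⟨w, hw, hprogram⟩ := exists_program_eq his
    exact ⟨w, hw, by rwa [hprogram]⟩

end Program

open Classical in
theorem eval_searchCode_eq_ite {n : ℕ} {G : SimpleGraph (Fin n)} {L : List (Fin n)} {M : ℕ → ℕ}
    {s : Store} (h : Ready G L M s) (hC : G.IsVertexCover L.toFinset) (hL : L.Nodup) :
    (searchCode.eval M s).var .answer = if MaxMinFVS G (s.var .goal) then 1 else 0 := by
  rw [eval_searchCode h]
  refine if_congr ?_ rfl rfl
  rw [maxMinFVS_iff_exists_build hC List.mem_finRange, Fintype.card_fin,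
    List.toFinset_card_of_nodup hL, exists_program_iff (P := fun is => s.var .goal +
      (build G L.toFinset (List.finRange n) is).card ≤ n)]
  simp only [mem_instrs]

/-! ### A vertex cover -/

section GreedyCover

variable {V : Type*} {G : SimpleGraph V} {L : List V} {a b : V}

/-- The vertices in `L` are the endpoints of the edges of a matching, listed edge by edge. -/
inductive ListsMatching (G : SimpleGraph V) : List V → Prop
  | nil : ListsMatching G []
  | append {L : List V} {a b : V} : ListsMatching G L → G.Adj a b → a ∉ L → b ∉ L →
      ListsMatching G (L ++ [a, b])

theorem ListsMatching.nodup (hL : ListsMatching G L) : L.Nodup := by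
  induction hL with
  | nil => exact List.nodup_nil
  | append _ hab ha hb ih =>
    rw [List.nodup_append]
    exact ⟨ih, by simp [hab.ne], by grind⟩

theorem ListsMatching.length_le (hL : ListsMatching G L) {X : Finset V}
    (hX : G.IsVertexCover X) : L.length ≤ 2 * X.card := by
  classical
  have hcount : L.length ≤ 2 * (L.filter (· ∈ X)).length := by
    induction hL with
    | nil => simp
    | @append L a b _ hab _ _ ih =>
      have hpair : 1 ≤ ([a, b].filter (· ∈ X)).length := by
        refine List.length_pos_iff_exists_mem.2 ?_
        rcases hX hab with ha | hb
        · exact ⟨a, by simpa using ha⟩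
        · exact ⟨b, by simpa using hb⟩
      rw [List.filter_append, List.length_append, List.length_append, List.length_cons,
        List.length_singleton]
      omega
  rw [← List.toFinset_card_of_nodup (hL.nodup.filter _)] at hcount
  refine hcount.trans (Nat.mul_le_mul_left 2 (Finset.card_le_card fun x hx => ?_))
  simpa using (List.mem_filter.1 (List.mem_toFinset.1 hx)).2

open Classical in
/-- Appends the endpoints of the edge `ab` if they are not covered by `L`. -/
noncomputable def coverStep (G : SimpleGraph V) (a : V) (L : List V) (b : V) : List V :=
  if G.Adj a b ∧ a ∉ L ∧ b ∉ L then L ++ [a, b] else L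

/-- The endpoints of a greedy maximal matching of the graph with vertex list `l`. -/
noncomputable def greedyCover (G : SimpleGraph V) (l : List V) : List V :=
  l.foldl (fun L a => l.foldl (coverStep G a) L) []

theorem listsMatching_greedyCover (l : List V) : ListsMatching G (greedyCover G l) := by
  refine List.foldlRecOn l _ .nil fun L hL a _ => List.foldlRecOn l _ hL fun L hL b _ => ?_
  unfold coverStep
  split_ifs with h
  · exact hL.append h.1 h.2.1 h.2.2
  · exact hL

theorem subset_coverStep : L ⊆ coverStep G a L b := by
  unfold coverStep
  split_ifs <;> simp

theorem mem_coverStep_of_adj (h : G.Adj a b) : a ∈ coverStep G a L b ∨ b ∈ coverStep G a L b := by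
  unfold coverStep
  split_ifs with hab
  · simp
  · simp only [h, true_and, not_and_or, not_not] at hab
    exact hab

theorem subset_foldl {α β : Type*} {f : List α → β → List α} (hf : ∀ L b, L ⊆ f L b)
    (l : List β) (L : List α) : L ⊆ l.foldl f L :=
  List.foldlRecOn (motive := fun L' => L ⊆ L') l f (List.Subset.refl L)
    fun L' h b _ => List.Subset.trans h (hf L' b)

theorem exists_subset_foldl {α β : Type*} {f : List α → β → List α} (hf : ∀ L b, L ⊆ f L b)
    {l : List β} {b : β} (hb : b ∈ l) (L : List α) : ∃ L', f L' b ⊆ l.foldl f L := by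
  induction l generalizing L with
  | nil => simp at hb
  | cons c l ih =>
    rcases List.mem_cons.1 hb with rfl | hb
    · exact ⟨L, subset_foldl hf l _⟩
    · exact ih hb _

theorem isVertexCover_greedyCover [DecidableEq V] {l : List V} (hl : ∀ v, v ∈ l) :
    G.IsVertexCover (greedyCover G l).toFinset := by
  intro a b hab
  obtain ⟨L₁, h₁⟩ := exists_subset_foldl (f := fun L a => l.foldl (coverStep G a) L)
    (fun L a => subset_foldl (fun _ _ => subset_coverStep) l L) (hl a) []
  obtain ⟨L₂, h₂⟩ := exists_subset_foldl (f := coverStep G a) (fun _ _ => subset_coverStep)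
    (hl b) L₁
  simp only [List.coe_toFinset, Set.mem_ofPred_eq]
  exact (mem_coverStep_of_adj hab).imp (fun h => h₁ (h₂ h)) fun h => h₁ (h₂ h)

end GreedyCover

theorem length_greedyCover_le_two_mul_vc {n : ℕ} (G : SimpleGraph (Fin n)) :
    (greedyCover G (List.finRange n)).length ≤ 2 * vc G := by
  obtain ⟨X, hX, hcov⟩ := G.vertexCoverNum_exists
  lift X to Finset (Fin n) using X.toFinite
  have hcard : X.card = vc G := by
    rw [← vc_spec, Set.encard_coe_eq_coe_finsetCard] at hX
    exact_mod_cast hX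
  exact hcard ▸ (listsMatching_greedyCover _).length_le hcov

/-- Computes the addresses of the rows of the adjacency matrix. -/
def rowsCode : Code :=
  .set .acc (.lit 0) ;;
  .loop .i .size
    (.put .row (.var .i) (.var .acc) ;; .set .acc (.add (.var .acc) (.var .size)))

/-- Appends the vertex `x` to the cover. -/
def pushCover (x : Var) : Code :=
  .put .cover (.var x) (.lit 1) ;;
  .put .list (.var .coverSize) (.var x) ;;
  .set .coverSize (.add (.var .coverSize) (.lit 1))

/-- Appends `i` and `j` to the cover if they are adjacent and neither of them is in the cover. -/
def coverStepCode : Code :=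
  .ite (edge .i .j)
    (.ite (.get .cover (.var .i)) .skip
      (.ite (.get .cover (.var .j)) .skip (pushCover .i ;; pushCover .j)))
    .skip

/-- Computes a vertex cover greedily. -/
def coverCode : Code :=
  rowsCode ;;
  clear .cover ;;
  .set .coverSize (.lit 0) ;;
  .loop .i .size (.loop .j .size coverStepCode)

variable {n : ℕ} {G : SimpleGraph (Fin n)} {L : List (Fin n)} {M : ℕ → ℕ} {s : Store}
  {a b v : Fin n}

theorem eval_rowsCode (hn : s.var .size = n) (hM : ∀ i j : Fin n, M (i * n + j) ≠ 0 ↔ G.Adj i j) :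
    HasMatrix G M (rowsCode.eval M s) := by
  have fr := (Stmt.set .acc (.lit 0) : Code).frame_eval M s
  have hn₁ := (fr.var .size rfl).trans hn
  have := Stmt.loop_rule (i := .i) (x := .size) (M := M)
    (p := .put .row (.var .i) (.var .acc) ;; .set .acc (.add (.var .acc) (.var .size)))
    (fun m s' => s'.var .acc = m * n ∧ ∀ i < m, s'.arr .row i = i * n)
    (s := (Stmt.set .acc (.lit 0) : Code).eval M s)
    (by simp [Stmt.eval, Expr.eval, Env.set_var]) fun m _ s' fr' ⟨hacc, hrow⟩ => by
      have hn' := (fr'.var .size rfl).trans hn₁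
      refine ⟨by simp [Stmt.eval, Expr.eval, Env.set_var, hacc, hn', Nat.add_mul], fun i hi => ?_⟩
      simp only [Stmt.eval, Expr.eval, Env.set_arr, Env.set_var, Env.put_arr, true_and, if_true,
        reduceCtorEq, if_false, hacc]
      split_ifs with him
      · rw [him]
      · exact hrow i (by omega)
  rw [hn₁] at this
  exact ⟨(Stmt.eval_var rfl).trans hn, this.2, hM⟩

theorem eval_pushCover (h : HasCover G L M s) {x : Var} (hx : s.var x = v) :
    HasCover G (L ++ [v]) M ((pushCover x).eval M s) := by
  simp only [pushCover, Stmt.eval, Expr.eval, Env.put_var, hx, h.coverSize]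
  refine ⟨⟨?_, fun i hi => ?_, h.adj⟩, ?_, fun u => ?_, fun k hk => ?_⟩
  · simp [Env.set_var, h.size]
  · simp [Env.put_arr, h.row i hi]
  · simp [Env.set_var]
  · have := h.cover u
    by_cases huv : u = v <;> simp_all [Env.put_arr, Fin.val_inj]
  · by_cases hkL : k < L.length
    · simp [Env.put_arr, hkL, hkL.ne, h.list k hkL]
    · obtain rfl : k = L.length := by simp at hk; omega
      simp [Env.put_arr]

theorem eval_coverStepCode (h : HasCover G L M s) (hi : s.var .i = a) (hj : s.var .j = b) :
    HasCover G (coverStep G a L b) M (coverStepCode.eval M s) := by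
  have hadj := h.edge_ne_zero_iff hi hj
  have ha : Expr.eval M s (.get .cover (.var .i)) ≠ 0 ↔ a ∈ L := by
    simp only [Expr.eval, hi, h.cover]
  have hb : Expr.eval M s (.get .cover (.var .j)) ≠ 0 ↔ b ∈ L := by
    simp only [Expr.eval, hj, h.cover]
  simp only [coverStepCode, Stmt.eval, hadj, ha, hb, coverStep]
  split_ifs with h₁ h₂ h₃ h₄ h₅ h₆ <;> first | exact h | tauto | skip
  have := eval_pushCover (eval_pushCover h hi) (x := .j) ((Stmt.eval_var rfl).trans hj)
  simpa using this

theorem eval_coverCode (hn : s.var .size = n) (hM : ∀ i j : Fin n, M (i * n + j) ≠ 0 ↔ G.Adj i j) :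
    HasCover G (greedyCover G (List.finRange n)) M (coverCode.eval M s) := by
  have h₁ := eval_rowsCode hn hM
  rw [coverCode, Stmt.eval_seq, Stmt.eval_seq, Stmt.eval_seq]
  generalize rowsCode.eval M s = s₁ at h₁ ⊢
  have h₂ := h₁.of_frame ((clear .cover).frame_eval M s₁) rfl rfl
  have hclear := eval_clear (M := M) (a := .cover) h₁.size
  generalize (clear .cover).eval M s₁ = s₂ at h₂ hclear ⊢
  have h₃ : HasCover G [] M ((Stmt.set .coverSize (.lit 0) : Code).eval M s₂) :=
    ⟨h₂.of_frame ((Stmt.set .coverSize (.lit 0) : Code).frame_eval M s₂) rfl rfl, rfl,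
      fun v => by simp [Stmt.eval, hclear v], by simp⟩
  refine Stmt.loop_rule_foldl h₃.size _ (fun L s' => HasCover G L M s') h₃ fun L a s' _ h => ?_
  have h' := h.of_frame ((Stmt.set .i (.lit a) : Code).frame_eval M s') rfl
  refine Stmt.loop_rule_foldl h'.size _ (fun L s' => HasCover G L M s') h' fun L b s'' fr h => ?_
  exact eval_coverStepCode (h.of_frame ((Stmt.set .j (.lit b) : Code).frame_eval M s'') rfl)
    ((fr.set_index b).var .i rfl) (by simp [Env.set_var])

/-- Prepares the search, except that `bound` is only initialized. -/
def prepareCode : Code :=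
  coverCode ;;
  .set .base (.add (.add (.var .coverSize) (.var .coverSize)) (.lit 2)) ;;
  .set .len (.add (.add (.var .coverSize) (.var .coverSize))
    (.add (.var .coverSize) (.var .coverSize))) ;;
  .set .bound (.lit 1)

/-- Multiplies `bound` by `base`. -/
def mulCode : Code :=
  .set .acc (.lit 0) ;;
  .loop .j .base (.set .acc (.add (.var .acc) (.var .bound))) ;;
  .set .bound (.var .acc)

/-- Computes the number of lists of instructions. -/
def powCode : Code := .loop .i .len mulCode

theorem eval_prepareCode (hn : s.var .size = n)
    (hM : ∀ i j : Fin n, M (i * n + j) ≠ 0 ↔ G.Adj i j) :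
    HasCover G (greedyCover G (List.finRange n)) M (prepareCode.eval M s) ∧
      (prepareCode.eval M s).var .base = (instrs (greedyCover G (List.finRange n))).length ∧
      (prepareCode.eval M s).var .len = 4 * (greedyCover G (List.finRange n)).length ∧
      (prepareCode.eval M s).var .bound = 1 := by
  have h := eval_coverCode hn hM
  rw [prepareCode, Stmt.eval_seq]
  generalize coverCode.eval M s = s₁ at h ⊢
  refine ⟨h.of_frame (Stmt.frame_eval M _ s₁) rfl, ?_⟩
  simp only [Stmt.eval, Expr.eval, Env.set_var, reduceCtorEq, if_false, if_true, h.coverSize,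
    length_instrs, and_true]
  omega

theorem eval_mulCode (M : ℕ → ℕ) (s : Store) :
    (mulCode.eval M s).var .bound = s.var .bound * s.var .base := by
  have := Stmt.loop_rule (i := .j) (x := .base) (M := M) (s := s.set .acc 0)
    (p := .set .acc (.add (.var .acc) (.var .bound)))
    (fun m s' => s'.var .acc = s.var .bound * m) (by simp [Env.set_var]) fun m _ s' fr hm => by
      have hbound := fr.var .bound rfl
      simp_all [Stmt.eval, Expr.eval, Env.set_var, Nat.mul_succ]
  simp only [Env.set_var, reduceCtorEq, if_false] at this
  simpa [mulCode, Stmt.eval, Expr.eval, Env.set_var] using this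

theorem eval_powCode (hbound : s.var .bound = 1) :
    (powCode.eval M s).var .bound = s.var .base ^ s.var .len := by
  refine Stmt.loop_rule (p := mulCode) (fun m s' => s'.var .bound = s.var .base ^ m)
    (by simpa using hbound) fun m _ s' fr hm => ?_
  rw [eval_mulCode, (fr.set_index m).var .base rfl, pow_succ, ← hm]
  simp [Env.set_var]

theorem ready_powCode (h : HasCover G L M s) (hbase : s.var .base = (instrs L).length)
    (hlen : s.var .len = 4 * L.length) (hbound : s.var .bound = 1) :
    Ready G L M (powCode.eval M s) where
  toHasCover := h.of_frame (powCode.frame_eval M s) rfl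
  len := (Stmt.eval_var rfl).trans hlen
  base := (Stmt.eval_var rfl).trans hbase
  bound := by rw [eval_powCode hbound, hbase, hlen]

/-! ### The machine program -/

section Machine

/-- Computes the square of register 0 in register `b`. -/
def squareCode (b : ℕ) : Prog :=
  .seq (.const b 0) (.seq (.move (b + 1) 0) (.seq (.const (b + 2) 1)
    (.loop (b + 1) (.seq (.add b b 0) (.sub (b + 1) (b + 1) (b + 2))))))

theorem exec_squareCode {b : ℕ} (hb : 0 < b) (s : State) :
    ∃ s', Exec (squareCode b) s s' (3 * s.reg 0 + 4) ∧ s'.mem = s.mem ∧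
      s'.reg b = s.reg 0 * s.reg 0 ∧ ∀ r < b, s'.reg r = s.reg r := by
  obtain ⟨s', hexec, -, hmem, hsquare, -, hkeep⟩ := Exec.loop_of_invariant (x := b + 1)
    (m := s.reg 0) (p := .seq (.add b b 0) (.sub (b + 1) (b + 1) (b + 2))) (c := fun _ => 2)
    (s := ((s.setReg b 0).setReg (b + 1) (s.reg 0)).setReg (b + 2) 1)
    (fun l s' => s'.reg (b + 1) = s.reg 0 - l ∧ s'.mem = s.mem ∧ s'.reg b = l * s.reg 0 ∧
      s'.reg (b + 2) = 1 ∧ ∀ r < b, s'.reg r = s.reg r)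
    (fun _ _ h => h.1)
    (fun l _ s' ⟨hcount, hmem, hsquare, hone, hkeep⟩ => by
      refine ⟨_, .seq (.add _ _ _ _) (.sub _ _ _ _), ?_, hmem, ?_, ?_, fun r hr => ?_⟩
      · simp [State.setReg, hcount, hone, Nat.sub_sub]
      · simp [State.setReg, hsquare, hkeep 0 hb, Nat.succ_mul]
      · simp [State.setReg, hone]
      · simp [State.setReg, hr.ne, (hr.trans b.lt_succ_self).ne, hkeep r hr])
    (by
      refine ⟨by simp [State.setReg], rfl, by simp [State.setReg], by simp [State.setReg],
        fun r hr => ?_⟩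
      simp [State.setReg, hr.ne, show r ≠ b + 1 by omega, show r ≠ b + 2 by omega])
  refine ⟨s', ?_, hmem, hsquare, hkeep⟩
  have hreg : (s.setReg b 0).reg 0 = s.reg 0 := by simp [State.setReg, hb.ne]
  have hall : Exec (squareCode b) s s' _ := .seq (.const b 0 s) (.seq (.move (b + 1) 0 _)
    (.seq (.const (b + 2) 1 _) (hreg.symm ▸ hexec)))
  rw [hreg, Finset.sum_const, Finset.card_range, smul_eq_mul] at hall
  convert hall using 1
  ring

/-- Decides Max Min FVS. -/
def solveCode : Code := prepareCode ;; powCode ;; searchCode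

/-- The program of the machine that decides Max Min FVS. -/
def maxMinFVSProg : Prog :=
  .seq (squareCode layout.base) (.seq (solveCode.compile layout (layout.base + 1))
    (.move 0 (layout.reg .answer)))

variable {n : ℕ} {G : SimpleGraph (Fin n)}

theorem input_mem_ne_zero_iff (k : ℕ) (i j : Fin n) :
    (input G k).mem (i * n + j) ≠ 0 ↔ G.Adj i j := by
  simp only [input, ne_eq, ite_eq_right_iff, one_ne_zero, imp_false, not_not]
  refine ⟨?_, fun h => ⟨i, j, rfl, h⟩⟩
  rintro ⟨i', j', heq, hadj⟩
  have hij : (i, j) = (i', j') := finProdFinEquiv.injective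
    (Fin.ext (by simpa [add_comm, mul_comm] using heq))
  rwa [(Prod.mk.inj hij).1, (Prod.mk.inj hij).2]

theorem input_mem_of_le (k : ℕ) {a : ℕ} (ha : n * n ≤ a) : (input G k).mem a = 0 := by
  refine if_neg ?_
  rintro ⟨i, j, rfl, -⟩
  have hlt : j + n * i < n * n := (finProdFinEquiv (i, j)).2
  rw [mul_comm n i] at hlt
  omega

/-- The environment in which the program is started. -/
def initialEnv (n k : ℕ) : Store where
  var x := if x = .size then n else if x = .goal then k else 0
  arr _ _ := 0

theorem represents_initialEnv (k : ℕ) {s : State} (hm : s.mem = (input G k).mem)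
    (hb : s.reg layout.base = n * n) (hr : ∀ r < layout.base, s.reg r = (input G k).reg r) :
    Represents layout (input G k).mem (n * n) s (initialEnv n k) where
  var x := by
    rw [hr _ (layout.reg_lt x)]
    cases x <;> rfl
  base := hb
  arr a i := by
    rw [hm]
    exact input_mem_of_le k (Nat.le_add_right _ _)
  inp i _ := by rw [hm]
  inp_zero i hi := input_mem_of_le k hi

open Classical in
theorem eval_solveCode (k : ℕ) :
    (solveCode.eval (input G k).mem (initialEnv n k)).var .answer =
      if MaxMinFVS G k then 1 else 0 := by
  obtain ⟨hcover, hbase, hlen, hbound⟩ := eval_prepareCode (G := G) (s := initialEnv n k) rfl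
    (input_mem_ne_zero_iff k)
  rw [solveCode, Stmt.eval_seq, Stmt.eval_seq,
    eval_searchCode_eq_ite (ready_powCode hcover hbase hlen hbound)
      (isVertexCover_greedyCover List.mem_finRange) (listsMatching_greedyCover _).nodup,
    Stmt.eval_var rfl, Stmt.eval_var rfl]
  rfl

/-- The number of lists of instructions that the search on `G` tries. -/
noncomputable def searchSize (G : SimpleGraph (Fin n)) : ℕ :=
  (2 * (greedyCover G (List.finRange n)).length + 2) ^
    (4 * (greedyCover G (List.finRange n)).length)

theorem time_solveCode_le (k : ℕ) :
    solveCode.time (input G k).mem (initialEnv n k) ≤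
      solveCode.cost (4 * ((n + 1) * searchSize G)) := by
  obtain ⟨hcover, hbase, hlen, hbound⟩ := eval_prepareCode (G := G) (s := initialEnv n k) rfl
    (input_mem_ne_zero_iff k)
  have hready := ready_powCode hcover hbase hlen hbound
  rw [length_instrs] at hbase
  have hsearch : searchSize G = _ := (length_instrs _ ▸ hready.bound).symm
  have hn : (greedyCover G (List.finRange n)).length ≤ n := by
    simpa using (listsMatching_greedyCover (G := G) (List.finRange n)).nodup.length_le_card
  have hpos : 1 ≤ searchSize G := Nat.one_le_pow _ _ (by omega)
  have hle : n + 1 ≤ (n + 1) * searchSize G := Nat.le_mul_of_pos_right _ hpos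
  have hle' : searchSize G ≤ (n + 1) * searchSize G := Nat.le_mul_of_pos_left _ n.succ_pos
  refine Nat.add_le_add (Stmt.time_le_cost (B := {.size}) rfl (by decide) ?_) (Nat.add_le_add
    (Stmt.time_le_cost (B := {.len, .base}) rfl (by decide) ?_)
    (Stmt.time_le_cost (B := {.size, .bound, .len}) rfl (by decide) ?_))
  · simp only [Finset.mem_singleton, forall_eq, initialEnv, if_true]
    omega
  · simp only [Finset.forall_mem_insert, Finset.mem_singleton, forall_eq]
    omega
  · simp only [Finset.forall_mem_insert, Finset.mem_singleton, forall_eq, hready.size, hready.len]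
    omega

theorem three_mul_add_le_mul_pow {n t K D X : ℕ} (hn : n + 1 ≤ X) (ht : t ≤ K * (4 * X + 1) ^ D) :
    3 * n + 4 + (t + 1) ≤ (K * 5 ^ D + 5) * X ^ (D + 1) :=
  calc 3 * n + 4 + (t + 1)
      ≤ K * (4 * X + 1) ^ D + 5 * X := by omega
    _ ≤ K * (5 * X) ^ D + 5 * X := by gcongr; omega
    _ = K * 5 ^ D * X ^ D + 5 * X := by ring
    _ ≤ K * 5 ^ D * X ^ (D + 1) + 5 * X ^ (D + 1) := by
      gcongr
      · omega
      · exact D.le_succ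
      · exact Nat.le_self_pow D.succ_ne_zero X
    _ = (K * 5 ^ D + 5) * X ^ (D + 1) := by ring

open Classical in
theorem exec_maxMinFVSProg : ∃ K D : ℕ, ∀ (n : ℕ) (G : SimpleGraph (Fin n)) (k : ℕ),
    ∃ s τ, Exec maxMinFVSProg (input G k) s τ ∧ τ ≤ K * ((n + 1) * searchSize G) ^ D ∧
      s.reg 0 = if MaxMinFVS G k then 1 else 0 := by
  obtain ⟨K, D, hcost⟩ := solveCode.cost_le
  refine ⟨K * 5 ^ D + 5, D + 1, fun n G k => ?_⟩
  obtain ⟨s₁, hexec₁, hmem, hsquare, hkeep⟩ := exec_squareCode (b := layout.base) (by decide)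
    (input G k)
  obtain ⟨s₂, hexec₂, hs₂, -⟩ := solveCode.simulates_compile (t := layout.base + 1) (by omega) s₁ _
    (represents_initialEnv k hmem hsquare hkeep)
  refine ⟨_, _, .seq hexec₁ (.seq hexec₂ (.move _ _ _)), ?_, ?_⟩
  · have hpos : 1 ≤ searchSize G := Nat.one_le_pow _ _ (by omega)
    exact three_mul_add_le_mul_pow (Nat.le_mul_of_pos_right _ hpos)
      ((time_solveCode_le k).trans (hcost _))
  · simp only [State.setReg, Function.update_self, hs₂.var, eval_solveCode]

theorem searchSize_le (G : SimpleGraph (Fin n)) : searchSize G ≤ 6 ^ 8 * vc G ^ (32 * vc G) := by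
  have hc := length_greedyCover_le_two_mul_vc G
  have hle : searchSize G ≤ (4 * vc G + 2) ^ (8 * vc G) :=
    (Nat.pow_le_pow_left (by omega) _).trans (Nat.pow_le_pow_right (by omega) (by omega))
  refine hle.trans ?_
  generalize vc G = v
  rcases Nat.lt_or_ge v 2 with hv | hv
  · interval_cases v <;> norm_num
  · have hbase : 4 * v + 2 ≤ v ^ 4 :=
      calc 4 * v + 2 ≤ 2 ^ 3 * v := by omega
        _ ≤ v ^ 3 * v := by gcongr
        _ = v ^ 4 := (pow_succ v 3).symm
    calc (4 * v + 2) ^ (8 * v) ≤ (v ^ 4) ^ (8 * v) := Nat.pow_le_pow_left hbase _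
      _ = v ^ (32 * v) := by rw [← pow_mul]; congr 1; ring
      _ ≤ 6 ^ 8 * v ^ (32 * v) := Nat.le_mul_of_pos_left _ (by norm_num)

theorem natCast_pow_mul_self_eq_rpow (B v : ℕ) :
    (v : ℝ) ^ (B * v) = 2 ^ ((B : ℝ) * (v * Real.logb 2 v)) := by
  rcases v.eq_zero_or_pos with rfl | hv
  · simp
  · have hexp : (B : ℝ) * (v * Real.logb 2 v) = Real.logb 2 v * (B * v : ℕ) := by
      push_cast
      ring
    rw [hexp, Real.rpow_mul (by norm_num), Real.rpow_natCast,
      Real.rpow_logb (by norm_num) (by norm_num) (by exact_mod_cast hv)]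

end Machine

end MaxMinFVS

theorem theorem2 :
    ∃ (p : RAM.Prog) (A B C : ℕ), ∀ (n : ℕ) (G : SimpleGraph (Fin n)) (k : ℕ),
      RAM.AnswersWithin p G k (MaxMinFVS G k)
        (A * (2 : ℝ) ^ ((B : ℝ) * ((vc G : ℝ) * Real.logb 2 (vc G))) * ((n : ℝ) + 1) ^ C) := by
  obtain ⟨K, D, h⟩ := MaxMinFVS.exec_maxMinFVSProg
  refine ⟨MaxMinFVS.maxMinFVSProg, K * (6 ^ 8) ^ D, 32 * D, D, fun n G k => ?_⟩
  obtain ⟨s, τ, hexec, hτ, hanswer⟩ := h n G k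
  refine ⟨s, τ, hexec, ?_, fun hQ => by simp [hanswer, hQ], fun hQ => by simp [hanswer, hQ]⟩
  rw [← MaxMinFVS.natCast_pow_mul_self_eq_rpow]
  have hle : τ ≤ K * (6 ^ 8) ^ D * vc G ^ (32 * D * vc G) * (n + 1) ^ D :=
    calc τ ≤ K * ((n + 1) * MaxMinFVS.searchSize G) ^ D := hτ
      _ ≤ K * ((n + 1) * (6 ^ 8 * vc G ^ (32 * vc G))) ^ D := by
        gcongr
        exact MaxMinFVS.searchSize_le G
      _ = K * (6 ^ 8) ^ D * vc G ^ (32 * D * vc G) * (n + 1) ^ D := by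
        rw [mul_pow, mul_pow, ← pow_mul (vc G), mul_right_comm 32]
        ring
  exact_mod_cast hle
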